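/- Let $S=\mathbb{C}[x,y,z]$ and let $C: f=0$ be a reduced curve of degree $d\ge 3$ in the complex projective plane $\mathbb{P}^2$, where $f\in S$ is homogeneous of degree $d$ and square-free. Let $d_1\le d_2\le\cdots\le d_m$ be the exponents of $C$, i.e. the degrees of a minimal system of homogeneous generators of the graded $S$-module of Jacobian syzygies $$\{(a,b,c)\in S^3 : a f_x+b f_y+c f_z=0\},$$ where a homogeneous syzygy $(a,b,c)$ has degree $k$ if $a,b,c$ are homogeneous of degree $k$. Let $\tau(C)$ be the total Tjurina number of $C$, i.e. the sum, over the singular points $p$ of $C$, of the Tjurina numbers $\dim_{\mathbb{C}}\mathcal{O}_{p}/(g,g_u,g_v)$, where $\mathcal{O}_p$ is the local ring of $\mathbb{P}^2$ at $p$ and $g(u,v)=0$ is an equation of $C$ in an affine chart around $p$ with affine coordinates $u,v$. Put $$\tau(d,d_1)_{max}=(d-1)^2-d_1(d-d_1-1).$$ The curve $C$ is called nearly free if $m=3$, $d_1+d_2=d$ and $d_2=d_3$, and minimal plus-one generated if $m=3$, $d_1+d_2=d$ and $d_3=d_2+1$. Then: 1. $C$ is nearly free if and only if $\tau(C)=\tau(d,d_1)_{max}-1$.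 2. $C$ is minimal plus-one generated if and only if $\tau(C)=\tau(d,d_1)_{max}-2$. -/

import Mathlib

open MvPolynomial

namespace PlaneCurve

/-- The homogeneous coordinate ring `ℂ[x, y, z]` of the complex projective plane. -/
abbrev S : Type := MvPolynomial (Fin 3) ℂ

/-- The complex projective plane. -/
abbrev Plane : Type := Projectivization ℂ (Fin 3 → ℂ)

/-- `C : f = 0` is a reduced plane curve of degree `d`: the form `f` is homogeneous of degree `d`
and has no multiple factor (in particular `f ≠ 0`). -/
structure IsReducedCurve (d : ℕ) (f : S) : Prop where
  isHomogeneous : f.IsHomogeneous d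
  squarefree : Squarefree f

/-! ### Jacobian syzygies and exponents -/

/-- The `S`-module of Jacobian syzygies of `f`: the triples `(a, b, c)` in `S³` with
`a * f_x + b * f_y + c * f_z = 0`. -/
def syzygies (f : S) : Submodule S (Fin 3 → S) where
  carrier := {a | ∑ i, a i * pderiv i f = 0}
  zero_mem' := by simp
  add_mem' := by
    intro a b ha hb
    simp only [Set.mem_ofPred_eq] at ha hb ⊢
    simp [add_mul, Finset.sum_add_distrib, ha, hb]
  smul_mem' := by
    intro c a ha
    simp only [Set.mem_ofPred_eq] at ha ⊢
    simp [mul_assoc, ← Finset.mul_sum, ha]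

/-- `r` is a minimal system of homogeneous generators of the module of Jacobian syzygies of `f`,
where the triple `r i` has all its components homogeneous of degree `e i`. -/
structure IsMinimalGenerators (f : S) {m : ℕ} (e : Fin m → ℕ) (r : Fin m → Fin 3 → S) : Prop where
  homogeneous : ∀ i j, (r i j).IsHomogeneous (e i)
  span_eq : Submodule.span S (Set.range r) = syzygies f
  minimal : ∀ i, r i ∉ Submodule.span S (r '' {j | j ≠ i})

/-- `(e 0, …, e (m - 1))` are the exponents `d_1 ≤ … ≤ d_m` of the curve `f = 0`: the degrees, in
increasing order, of a minimal system of homogeneous generators of the syzygy module. -/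
def HasExponents (f : S) {m : ℕ} (e : Fin m → ℕ) : Prop :=
  Monotone e ∧ ∃ r : Fin m → Fin 3 → S, IsMinimalGenerators f e r

/-- The curve `f = 0` of degree `d` is nearly free: it is a 3-syzygy curve (its syzygy module has
exactly three minimal generators) whose exponents satisfy `d_1 + d_2 = d` and `d_2 = d_3`. -/
def IsNearlyFree (d : ℕ) (f : S) : Prop :=
  ∃ e : Fin 3 → ℕ, HasExponents f e ∧ e 0 + e 1 = d ∧ e 1 = e 2

/-- The curve `f = 0` of degree `d` is minimal plus-one generated: it is a 3-syzygy curve whose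
exponents satisfy `d_1 + d_2 = d` and `d_2 + 1 = d_3`. -/
def IsMinimalPlusOneGenerated (d : ℕ) (f : S) : Prop :=
  ∃ e : Fin 3 → ℕ, HasExponents f e ∧ e 0 + e 1 = d ∧ e 1 + 1 = e 2

/-! ### Tjurina numbers -/

/-- The maximal ideal of `ℂ[u, v]` of the polynomials vanishing at the point `a`. -/
noncomputable abbrev pointIdeal (a : Fin 2 → ℂ) : Ideal (MvPolynomial (Fin 2) ℂ) :=
  RingHom.ker (MvPolynomial.eval a)

instance pointIdeal_isPrime (a : Fin 2 → ℂ) : (pointIdeal a).IsPrime :=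
  RingHom.ker_isPrime (MvPolynomial.eval a)

/-- The local ring of the affine plane at the point `a`. -/
abbrev LocalRingAt (a : Fin 2 → ℂ) : Type :=
  Localization.AtPrime (pointIdeal a)

/-- The Tjurina ideal `(g, g_u, g_v)` in the local ring of the affine plane at `a`. -/
noncomputable def tjurinaIdeal (g : MvPolynomial (Fin 2) ℂ) (a : Fin 2 → ℂ) :
    Ideal (LocalRingAt a) :=
  Ideal.map (algebraMap (MvPolynomial (Fin 2) ℂ) (LocalRingAt a))
    (Ideal.span {g, pderiv 0 g, pderiv 1 g})

/-- The Tjurina number at `a` of the affine plane curve `g = 0`: the complex dimension of its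
Tjurina algebra at `a`. -/
noncomputable def affineTjurina (g : MvPolynomial (Fin 2) ℂ) (a : Fin 2 → ℂ) : ℕ :=
  Module.finrank ℂ (LocalRingAt a ⧸ tjurinaIdeal g a)

/-- The affine equation of `f = 0` in the chart where the coordinate of index `i` is `1`. -/
noncomputable def dehomogenize (i : Fin 3) (f : S) : MvPolynomial (Fin 2) ℂ :=
  aeval (i.insertNth (1 : MvPolynomial (Fin 2) ℂ) X : Fin 3 → MvPolynomial (Fin 2) ℂ) f

/-- The index of a coordinate that does not vanish at `p`. -/
noncomputable def chartIndex (p : Plane) : Fin 3 :=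
  Classical.choose (Function.ne_iff.mp p.rep_nonzero)

theorem rep_chartIndex_ne_zero (p : Plane) : p.rep (chartIndex p) ≠ 0 :=
  Classical.choose_spec (Function.ne_iff.mp p.rep_nonzero)

/-- The affine coordinates of `p` in the chart given by `chartIndex p`. -/
noncomputable def affineCoord (p : Plane) : Fin 2 → ℂ :=
  fun j => p.rep ((chartIndex p).succAbove j) / p.rep (chartIndex p)

/-- The Tjurina number at `p` of the plane curve `f = 0`, computed in an affine chart
around `p`. -/
noncomputable def tjurinaAt (f : S) (p : Plane) : ℕ :=
  affineTjurina (dehomogenize (chartIndex p) f) (affineCoord p)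

/-- The singular points of the plane curve `f = 0`. -/
def singularPoints (f : S) : Set Plane :=
  {p | eval p.rep f = 0 ∧ ∀ i, eval p.rep (pderiv i f) = 0}

/-- The total Tjurina number of the plane curve `f = 0`: the sum of the Tjurina numbers of its
singular points (finitely many when the curve is reduced). -/
noncomputable def totalTjurina (f : S) : ℕ :=
  ∑ᶠ p ∈ singularPoints f, tjurinaAt f p

/-- The integer `τ(d, d₁)_max = (d - 1)² - d₁ (d - d₁ - 1)`. -/
def tauMax (d d₁ : ℕ) : ℤ :=
  ((d : ℤ) - 1) ^ 2 - (d₁ : ℤ) * ((d : ℤ) - (d₁ : ℤ) - 1)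

end PlaneCurve

/-! Let `a` be a nonzero homogeneous syzygy of least degree `r = d₁`. For any syzygy `b`, both `a`
and `b` are orthogonal to the gradient of `f`, so `a × b = h ∇f` over the fraction field. The
partials of a reduced `f` have no common prime, so `h` is a polynomial. These `h` form the graded
ideal `I = cofactorIdeal f a`, and `b ↦ h` has kernel `S a`, because minimality of `r` makes `a`
primitive as well. Up to degree shifts the syzygy module is thus an extension of `I` by `S`, and
everything is read off `I`.

The number `τ` enters as the eventual Hilbert function of `S / (f_x, f_y, f_z)`: a general plane `ℓ
= 1` cuts the cone of the Jacobian ideal in a finite scheme whose local rings are the Tjurina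
algebras (`totalTjurina_eq_finrank`). Counting dimensions in the two exact sequences shows that `S /
I` has constant Hilbert polynomial `n = τ(d, r)_max - τ` (`exists_finrank_cofactorIdeal`).

A general linear form is a nonzerodivisor on `S / I` (`exists_linearForm_regular`), so its Hilbert
function increases strictly from `1` until it is constant, equal to `n`. For `n = 1` it is `1, 1, …`
and `I` is generated by two linear forms; for `n = 2` it is `1, 2, 2, …` and `I` is generated by a
linear form and a quadric. Lifting the two generators to syzygies `b`, `c` gives the minimal
generators `a, b, c` with the required degrees. Conversely, three minimal generators with `d₁ + d₂ =
d` and `d₃ = d₂ + n - 1` make `I` generated by coprime forms of degrees `1` and `n`, whose quotient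
has Hilbert polynomial `n`. -/

namespace PlaneCurve

/-! ### Homogeneous components and graded ideals -/

section Graded

variable {σ : Type*}

theorem homogeneousComponent_homogeneous_mul {n : ℕ} {p : MvPolynomial σ ℂ} (hp : p.IsHomogeneous n)
    (q : MvPolynomial σ ℂ) (k : ℕ) :
    homogeneousComponent (n + k) (p * q) = p * homogeneousComponent k q := by
  have h : ∀ j, homogeneousComponent (n + k) (p * homogeneousComponent j q) =
      if j = k then p * homogeneousComponent j q else 0 := fun j => by
    rw [homogeneousComponent_of_mem (hp.mul (homogeneousComponent_isHomogeneous j q))]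
    simp [eq_comm]
  conv_lhs => rw [← sum_homogeneousComponent q]
  rw [Finset.mul_sum, map_sum, Finset.sum_congr rfl fun j _ => h j, Finset.sum_ite_eq']
  split_ifs with hk
  · rfl
  · rw [homogeneousComponent_eq_zero k q (by simpa [Nat.lt_succ_iff] using hk), mul_zero]

theorem homogeneousComponent_homogeneous_mul_of_lt {n : ℕ} {p : MvPolynomial σ ℂ}
    (hp : p.IsHomogeneous n) (q : MvPolynomial σ ℂ) {k : ℕ} (hk : k < n) :
    homogeneousComponent k (p * q) = 0 := by
  rw [← sum_homogeneousComponent q, Finset.mul_sum, map_sum]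
  refine Finset.sum_eq_zero fun j _ => ?_
  rw [homogeneousComponent_of_mem (hp.mul (homogeneousComponent_isHomogeneous j q)),
    if_neg (by omega)]

/-- An ideal containing the homogeneous components of its elements. -/
def IsGradedIdeal (I : Ideal (MvPolynomial σ ℂ)) : Prop :=
  ∀ F ∈ I, ∀ k, homogeneousComponent k F ∈ I

theorem exists_homogeneous_coeff {ι : Type*} [Fintype ι] {a : ι → MvPolynomial σ ℂ} {n : ι → ℕ}
    (ha : ∀ i, (a i).IsHomogeneous (n i)) {F : MvPolynomial σ ℂ} {k : ℕ}
    (hF : F.IsHomogeneous k) (hk : ∀ i, n i ≤ k) (hm : F ∈ Ideal.span (Set.range a)) :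
    ∃ c : ι → MvPolynomial σ ℂ, (∀ i, (c i).IsHomogeneous (k - n i)) ∧ ∑ i, c i * a i = F := by
  obtain ⟨c, hc⟩ := (Ideal.mem_span_range_iff_exists_fun).1 hm
  refine ⟨fun i => homogeneousComponent (k - n i) (c i),
    fun i => homogeneousComponent_isHomogeneous _ _, ?_⟩
  have h := congrArg (homogeneousComponent k) hc
  rw [homogeneousComponent_eq_self hF, map_sum] at h
  rw [← h]
  refine Finset.sum_congr rfl fun i _ => ?_
  have := homogeneousComponent_homogeneous_mul (ha i) (c i) (k - n i)
  rw [Nat.add_sub_cancel' (hk i)] at this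
  rw [mul_comm (c i), this, mul_comm]

theorem isGradedIdeal_span {ι : Type*} [Fintype ι] {a : ι → MvPolynomial σ ℂ} {n : ι → ℕ}
    (ha : ∀ i, (a i).IsHomogeneous (n i)) : IsGradedIdeal (Ideal.span (Set.range a)) := by
  intro F hF k
  obtain ⟨c, hc⟩ := (Ideal.mem_span_range_iff_exists_fun).1 hF
  rw [← hc, map_sum]
  refine Ideal.sum_mem _ fun i _ => ?_
  rw [mul_comm]
  rcases lt_or_ge k (n i) with h | h
  · rw [homogeneousComponent_homogeneous_mul_of_lt (ha i) _ h]; exact zero_mem _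
  · obtain ⟨j, rfl⟩ := Nat.exists_eq_add_of_le h
    rw [homogeneousComponent_homogeneous_mul (ha i)]
    exact Ideal.mul_mem_right _ _ (Ideal.subset_span ⟨i, rfl⟩)

theorem mem_of_homogeneousComponent_mem {I : Ideal (MvPolynomial σ ℂ)} {F : MvPolynomial σ ℂ}
    (h : ∀ k, homogeneousComponent k F ∈ I) : F ∈ I := by
  rw [← sum_homogeneousComponent F]
  exact Ideal.sum_mem _ fun k _ => h k

theorem exists_homogeneousComponent_ne_zero {F : MvPolynomial σ ℂ} (hF : F ≠ 0) :
    ∃ k ≤ F.totalDegree, homogeneousComponent k F ≠ 0 := by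
  by_contra! h
  apply hF
  rw [← sum_homogeneousComponent F]
  exact Finset.sum_eq_zero fun k hk => h k (by simpa [Nat.lt_succ_iff] using hk)

end Graded

/-! ### Dimensions of graded pieces -/

theorem finrank_map_add_finrank_inf_ker {V W : Type*} [AddCommGroup V] [Module ℂ V]
    [AddCommGroup W] [Module ℂ W] (g : V →ₗ[ℂ] W) (p : Submodule ℂ V) [FiniteDimensional ℂ p] :
    Module.finrank ℂ (p.map g) + Module.finrank ℂ ↥(p ⊓ LinearMap.ker g) = Module.finrank ℂ p := by
  have h := LinearMap.finrank_range_add_finrank_ker (g.domRestrict p)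
  rw [LinearMap.range_domRestrict, LinearMap.ker_domRestrict] at h
  rw [← h]
  congr 1
  rw [← Submodule.finrank_map_subtype_eq p, Submodule.map_comap_subtype]

theorem finrank_map_of_injective {V W : Type*} [AddCommGroup V] [Module ℂ V]
    [AddCommGroup W] [Module ℂ W] (g : V →ₗ[ℂ] W) (hg : Function.Injective g)
    (p : Submodule ℂ V) : Module.finrank ℂ (p.map g) = Module.finrank ℂ p :=
  (p.equivMapOfInjective g hg).finrank_eq.symm

/-- The forms of degree `k` in `ℂ[x, y, z]`. -/
noncomputable abbrev forms (k : ℕ) : Submodule ℂ S := homogeneousSubmodule (Fin 3) ℂ k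

theorem finrank_forms (k : ℕ) : Module.finrank ℂ (forms k) = (k + 2).choose 2 := by
  have hset : {m : Fin 3 →₀ ℕ | m.degree = k} =
      ((Finset.univ : Finset (Fin 3)).finsuppAntidiag k : Set (Fin 3 →₀ ℕ)) := by
    ext m
    simp [Finset.mem_finsuppAntidiag, Finsupp.degree_eq_sum]
  have e := (LinearEquiv.ofEq _ _ (homogeneousSubmodule_eq_finsupp_supported (Fin 3) ℂ k)).trans
    (AddMonoidAlgebra.supportedEquivFinsupp (R := ℂ) (S := ℂ) {m : Fin 3 →₀ ℕ | m.degree = k})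
  rw [e.finrank_eq, hset, Module.finrank_finsupp_self]
  rw [← Nat.card_eq_fintype_card, Nat.card_coe_set_eq, Set.ncard_coe_finset,
    Finset.card_finsuppAntidiag_nat_eq_choose]
  simp only [Finset.card_univ, Fintype.card_fin]
  rw [show 3 + k - 1 = k + 2 by omega, Nat.choose_symm_add]

instance (k : ℕ) : FiniteDimensional ℂ (forms k) :=
  Module.Finite.iff_fg.2 (homogeneousSubmodule_fg _ _ k)

/-- The forms of degree `k` in an ideal. -/
noncomputable def gradedPiece (I : Ideal S) (k : ℕ) : Submodule ℂ S :=
  I.restrictScalars ℂ ⊓ forms k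

theorem mem_gradedPiece {I : Ideal S} {k : ℕ} {F : S} :
    F ∈ gradedPiece I k ↔ F ∈ I ∧ F.IsHomogeneous k := by
  simp [gradedPiece]

instance (I : Ideal S) (k : ℕ) : FiniteDimensional ℂ (gradedPiece I k) :=
  Submodule.finiteDimensional_of_le (inf_le_right : gradedPiece I k ≤ forms k)

/-- Triples of forms of degree `k`. -/
noncomputable def vectorForms (k : ℕ) : Submodule ℂ (Fin 3 → S) :=
  Submodule.pi Set.univ fun _ => forms k

theorem mem_vectorForms {k : ℕ} {v : Fin 3 → S} :
    v ∈ vectorForms k ↔ ∀ i, (v i).IsHomogeneous k := by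
  simp [vectorForms, Submodule.mem_pi]

/-! ### Primitive vectors -/

/-- No prime divides all the components of the vector `a`. -/
def IsPrimitiveVector {R ι : Type*} [CommRing R] (a : ι → R) : Prop :=
  ∀ p, Prime p → ∃ i, ¬ p ∣ a i

/-- Remove the primes of `c` one at a time: each prime `p` misses some component `a j`, hence
divides `v`, and can be cancelled from both sides. -/
theorem IsPrimitiveVector.dvd_of_dvd_mul {R ι : Type*} [CommRing R] [IsDomain R]
    [UniqueFactorizationMonoid R] {a : ι → R} (ha : IsPrimitiveVector a) (c : R) :
    c ≠ 0 → ∀ v : R, (∀ j, c ∣ v * a j) → c ∣ v := by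
  induction c using UniqueFactorizationMonoid.induction_on_prime with
  | h₁ => intro h; exact absurd rfl h
  | h₂ x hx => intro _ v _; exact hx.dvd
  | h₃ c p hc hp ih =>
    intro _ v hv
    obtain ⟨j, hj⟩ := ha p hp
    obtain ⟨w, rfl⟩ : p ∣ v :=
      (hp.dvd_or_dvd ((Dvd.intro _ rfl).trans (hv j))).resolve_right hj
    refine mul_dvd_mul_left p (ih hc w fun i => ?_)
    have := hv i
    rw [mul_assoc] at this
    exact (mul_dvd_mul_iff_left hp.ne_zero).1 this

/-- A vector parallel to a primitive vector is a multiple of it. -/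
theorem IsPrimitiveVector.exists_eq_mul {R ι : Type*} [CommRing R] [IsDomain R]
    [UniqueFactorizationMonoid R] {a v : ι → R} (ha : IsPrimitiveVector a) {i₀ : ι}
    (h₀ : a i₀ ≠ 0) (h : ∀ i j, v i * a j = v j * a i) : ∃ s, ∀ i, v i = s * a i := by
  obtain ⟨s, hs⟩ := ha.dvd_of_dvd_mul (a i₀) h₀ (v i₀) fun j => ⟨v j, by rw [h, mul_comm]⟩
  refine ⟨s, fun i => mul_right_cancel₀ h₀ ?_⟩
  rw [h, hs]; ring

theorem isUnit_of_totalDegree_eq_zero {σ : Type*} {p : MvPolynomial σ ℂ} (h0 : p ≠ 0)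
    (h : p.totalDegree = 0) : IsUnit p := by
  obtain ⟨c, rfl⟩ : ∃ c, p = C c := ⟨_, totalDegree_eq_zero_iff_eq_C.1 h⟩
  exact (isUnit_iff_ne_zero.2 fun hc => h0 (by rw [hc, C_0])).map C

theorem totalDegree_pos_of_prime {σ : Type*} {p : MvPolynomial σ ℂ} (hp : Prime p) :
    0 < p.totalDegree :=
  Nat.pos_of_ne_zero fun h => hp.not_isUnit (isUnit_of_totalDegree_eq_zero hp.ne_zero h)

theorem prime_of_totalDegree_eq_one {σ : Type*} {p : MvPolynomial σ ℂ}
    (h : p.totalDegree = 1) : Prime p := by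
  have hp : p ≠ 0 := by rintro rfl; simp at h
  refine UniqueFactorizationMonoid.irreducible_iff_prime.1 ⟨fun hu => ?_, fun a b hab => ?_⟩
  · obtain ⟨q, hq⟩ := hu.exists_right_inv
    have := congrArg totalDegree hq
    rw [totalDegree_mul_of_isDomain hp (right_ne_zero_of_mul_eq_one hq), totalDegree_one] at this
    omega
  · have ha : a ≠ 0 := by rintro rfl; simp [hab] at hp
    have hb : b ≠ 0 := by rintro rfl; simp [hab] at hp
    rw [hab, totalDegree_mul_of_isDomain ha hb] at h
    rcases Nat.eq_zero_or_pos a.totalDegree with h0 | h0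
    · exact Or.inl (isUnit_of_totalDegree_eq_zero ha h0)
    · exact Or.inr (isUnit_of_totalDegree_eq_zero hb (by omega))

theorem IsPrimitiveVector.exists_ne_zero {n : ℕ} {ι : Type*} {a : ι → MvPolynomial (Fin (n + 1)) ℂ}
    (ha : IsPrimitiveVector a) : ∃ i, a i ≠ 0 := by
  obtain ⟨i, hi⟩ := ha _ (prime_of_totalDegree_eq_one (totalDegree_X (R := ℂ) (0 : Fin (n + 1))))
  exact ⟨i, fun h => hi (h ▸ dvd_zero _)⟩

/-! ### The gradient of a reduced curve -/

theorem totalDegree_pderiv_lt {σ : Type*} {i : σ} {p : MvPolynomial σ ℂ}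
    (h : pderiv i p ≠ 0) : (pderiv i p).totalDegree < p.totalDegree := by
  obtain ⟨m, hm, hd⟩ := Finset.exists_mem_eq_sup (pderiv i p).support (by simpa using h)
    (fun m => m.sum fun _ e => e)
  rw [totalDegree, hd]
  rw [mem_support_iff, coeff_pderiv] at hm
  have := le_totalDegree (mem_support_iff.2 (left_ne_zero_of_mul hm))
  have e : ((m + Finsupp.single i 1).sum fun _ e => e) = (m.sum fun _ e => e) + 1 := by
    rw [Finsupp.sum_add_index' (by simp) (by simp)]; simp
  omega

theorem totalDegree_eq_zero_of_pderiv_eq_zero {σ : Type*} {p : MvPolynomial σ ℂ}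
    (h : ∀ i, pderiv i p = 0) : p.totalDegree = 0 := by
  rw [totalDegree_eq_zero_iff]
  intro m hm i
  by_contra hi
  have h2 := congrArg (coeff (m - Finsupp.single i 1)) (h i)
  rw [coeff_pderiv, tsub_add_cancel_of_le (by simpa [Nat.one_le_iff_ne_zero] using hi)] at h2
  rw [coeff_zero, mul_eq_zero] at h2
  rcases h2 with h2 | h2
  · exact (mem_support_iff.1 hm) h2
  · exact (Nat.cast_add_one_ne_zero _) h2

theorem IsReducedCurve.euler {d : ℕ} {f : S} (hf : IsReducedCurve d f) :
    ∑ i, X i * pderiv i f = (d : S) * f := by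
  rw [hf.isHomogeneous.sum_X_mul_pderiv, nsmul_eq_mul]

/-- By Euler's relation a common prime `p` of the partials divides `f = p h`, and `p ∤ h` since `f`
is squarefree. The product rule then gives `p ∣ ∂p` for every partial derivative; for degree reasons
all of them vanish, so `p` is constant in characteristic zero. -/
theorem IsReducedCurve.isPrimitiveVector_gradient {d : ℕ} {f : S} (hf : IsReducedCurve d f)
    (hd : 0 < d) : IsPrimitiveVector fun i => pderiv i f := by
  intro p hp
  by_contra! hdvd
  have hpf : p ∣ f := by
    have h1 : p ∣ (d : S) * f := by
      rw [← hf.euler]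
      exact Finset.dvd_sum fun i _ => (hdvd i).mul_left _
    have hu : IsUnit (d : S) := by
      have : (d : S) = C (d : ℂ) := by simp
      rw [this]
      exact (isUnit_iff_ne_zero.2 (by exact_mod_cast hd.ne')).map C
    exact (hu.dvd_mul_left).1 h1
  obtain ⟨h, rfl⟩ := hpf
  have hnd : ¬ p ∣ h := fun ⟨w, hw⟩ => hp.not_isUnit (hf.squarefree p ⟨w, by rw [hw]; ring⟩)
  have hz : ∀ i, pderiv i p = 0 := by
    intro i
    by_contra hne
    have h1 : p ∣ h * pderiv i p := by
      have := hdvd i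
      simp only [pderiv_mul] at this
      rw [mul_comm h]
      exact (dvd_add_left (Dvd.intro _ rfl)).1 this
    obtain ⟨w, hw⟩ := (hp.dvd_or_dvd h1).resolve_left hnd
    have h2 := totalDegree_pderiv_lt hne
    rw [hw, totalDegree_mul_of_isDomain hp.ne_zero (by rintro rfl; simp [hw] at hne)] at h2
    omega
  exact (totalDegree_pos_of_prime hp).ne' (totalDegree_eq_zero_of_pderiv_eq_zero hz)

/-! ### Syzygies of minimal degree -/

theorem mem_syzygies {f : S} {a : Fin 3 → S} : a ∈ syzygies f ↔ ∑ i, a i * pderiv i f = 0 :=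
  Iff.rfl

theorem homogeneousComponent_mem_syzygies {d : ℕ} {f : S} (hf : f.IsHomogeneous d)
    {a : Fin 3 → S} (ha : a ∈ syzygies f) (k : ℕ) :
    (fun i => homogeneousComponent k (a i)) ∈ syzygies f := by
  rw [mem_syzygies] at ha ⊢
  have h := congrArg (homogeneousComponent (d - 1 + k)) ha
  rw [map_sum, map_zero] at h
  rw [← h]
  refine Finset.sum_congr rfl fun i _ => ?_
  rw [mul_comm (a i), homogeneousComponent_homogeneous_mul hf.pderiv, mul_comm]

/-- `a` is a nonzero homogeneous Jacobian syzygy of minimal degree `r`. -/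
structure IsMinimalSyzygy (f : S) (r : ℕ) (a : Fin 3 → S) : Prop where
  mem : a ∈ syzygies f
  homogeneous : ∀ i, (a i).IsHomogeneous r
  ne_zero : a ≠ 0
  minimal : ∀ b ∈ syzygies f, ∀ k, (∀ i, (b i).IsHomogeneous k) → b ≠ 0 → r ≤ k

/-- Dividing `a` by a common prime leaves a syzygy of smaller degree. The prime is not known to be
homogeneous, so the contradiction comes from a nonzero homogeneous component of the quotient. -/
theorem IsMinimalSyzygy.isPrimitiveVector {d r : ℕ} {f : S} {a : Fin 3 → S}
    (hf : f.IsHomogeneous d) (ha : IsMinimalSyzygy f r a) : IsPrimitiveVector a := by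
  intro p hp
  by_contra! hdvd
  choose b hb using hdvd
  have hbs : b ∈ syzygies f := by
    have h := mem_syzygies.1 ha.mem
    simp only [hb, mul_assoc, ← Finset.mul_sum] at h
    exact (mul_eq_zero.1 h).resolve_left hp.ne_zero
  obtain ⟨i, hi⟩ : ∃ i, b i ≠ 0 := by
    by_contra! h
    exact ha.ne_zero (funext fun i => by rw [hb, h, mul_zero]; rfl)
  obtain ⟨k, hk, hne⟩ := exists_homogeneousComponent_ne_zero hi
  have h1 := ha.minimal _ (homogeneousComponent_mem_syzygies hf hbs k) k
    (fun i => homogeneousComponent_isHomogeneous _ _) fun h => hne (congrFun h i)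
  have h2 := (ha.homogeneous i).totalDegree_le
  rw [hb, totalDegree_mul_of_isDomain hp.ne_zero hi] at h2
  have := totalDegree_pos_of_prime hp
  omega

/-- A combination of generators of degree at least `e 0` has no component of smaller degree. Hence
the first exponent is intrinsic, which makes it comparable between different systems of generators.
-/
theorem IsMinimalGenerators.isMinimalSyzygy {f : S} {m : ℕ}
    {e : Fin m → ℕ} (he : Monotone e) {r : Fin m → Fin 3 → S} (hr : IsMinimalGenerators f e r)
    (hm : 0 < m) : IsMinimalSyzygy f (e ⟨0, hm⟩) (r ⟨0, hm⟩) where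
  mem := hr.span_eq ▸ Submodule.subset_span ⟨_, rfl⟩
  homogeneous := hr.homogeneous _
  ne_zero h := hr.minimal ⟨0, hm⟩ (h ▸ zero_mem _)
  minimal b hb k hk hne := by
    by_contra! hlt
    apply hne
    rw [← hr.span_eq] at hb
    obtain ⟨c, hc⟩ := (Submodule.mem_span_range_iff_exists_fun S).1 hb
    funext i
    rw [← homogeneousComponent_eq_self (hk i), ← hc]
    simp only [Finset.sum_apply, Pi.smul_apply, smul_eq_mul, map_sum, Pi.zero_apply]
    refine Finset.sum_eq_zero fun j _ => ?_
    rw [mul_comm, homogeneousComponent_homogeneous_mul_of_lt (hr.homogeneous j i)]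
    exact hlt.trans_le (he (Fin.mk_le_of_le_val (Nat.zero_le _)))

/-! ### Finiteness of the zero set of a primitive vector of forms -/

/-- The scalar `c` lives in an arbitrary algebra because it will be the variable of `ℂ[t]` or a unit
of a local ring, when changing between a chart and the plane `ℓ = 1`. -/
theorem aeval_mul_of_isHomogeneous {σ A : Type*} [Fintype σ] [CommRing A] [Algebra ℂ A]
    {F : MvPolynomial σ ℂ} {k : ℕ} (hF : F.IsHomogeneous k) (c : A) (v : σ → A) :
    aeval (fun j => c * v j) F = c ^ k * aeval v F := by
  rw [aeval_def, aeval_def, eval₂_eq', eval₂_eq', Finset.mul_sum]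
  refine Finset.sum_congr rfl fun m hm => ?_
  have hd : ∑ i, m i = k := by
    rw [← Finsupp.degree_eq_sum]
    by_contra h
    exact (mem_support_iff.1 hm) (hF.coeff_eq_zero h)
  simp only [mul_pow, Finset.prod_mul_distrib, Finset.prod_pow_eq_pow_sum, hd]
  ring

theorem eval_smul_of_isHomogeneous {σ : Type*} [Fintype σ]
    {F : MvPolynomial σ ℂ} {k : ℕ} (hF : F.IsHomogeneous k) (c : ℂ) (v : σ → ℂ) :
    eval (c • v) F = c ^ k * eval v F := by
  have := aeval_mul_of_isHomogeneous hF c v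
  simp only [aeval_eq_eval] at this
  exact this

/-- The prime ideal of the polynomials vanishing on the line spanned by `w`. -/
noncomputable def lineIdeal (w : Fin 3 → ℂ) : Ideal S :=
  RingHom.ker (aeval (fun j => Polynomial.X * Polynomial.C (w j)) : S →ₐ[ℂ] Polynomial ℂ)

instance (w : Fin 3 → ℂ) : (lineIdeal w).IsPrime := RingHom.ker_isPrime _

theorem mem_lineIdeal_of_isHomogeneous {F : S} {k : ℕ} (hF : F.IsHomogeneous k) {w : Fin 3 → ℂ} :
    F ∈ lineIdeal w ↔ eval w F = 0 := by
  have h : aeval (fun j => Polynomial.C (w j)) F = Polynomial.C (eval w F) := by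
    have := MvPolynomial.aeval_algebraMap_apply (Polynomial ℂ) w F
    simp only [aeval_eq_eval] at this
    exact this
  rw [lineIdeal, RingHom.mem_ker, aeval_mul_of_isHomogeneous hF, h]
  simp

theorem smul_X_sub_mem_lineIdeal (w v : Fin 3 → ℂ) (i j : Fin 3) :
    C (w j) * X i - C (w i) * X j ∈ lineIdeal v ↔ w j * v i = w i * v j := by
  rw [mem_lineIdeal_of_isHomogeneous
    (((isHomogeneous_X ℂ i).C_mul _).sub ((isHomogeneous_X ℂ j).C_mul _))]
  simp [sub_eq_zero]

theorem parallel_of_lineIdeal_eq {w v : Fin 3 → ℂ} (h : lineIdeal w = lineIdeal v) (i j : Fin 3) :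
    w j * v i = w i * v j := by
  rw [← smul_X_sub_mem_lineIdeal, ← h, smul_X_sub_mem_lineIdeal, mul_comm]

theorem lineIdeal_lt_pointIdeal {w : Fin 3 → ℂ} (hw : w ≠ 0) :
    lineIdeal w < RingHom.ker (eval w : S →+* ℂ) := by
  refine lt_of_le_of_ne (fun F hF => ?_) fun h => ?_
  · rw [lineIdeal, RingHom.mem_ker] at hF
    have h1 := congrArg (Polynomial.aeval (1 : ℂ)) hF
    rw [RingHom.mem_ker, ← coe_aeval_eq_eval]
    have h2 : (Polynomial.aeval (1 : ℂ)).comp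
        (aeval (fun j => Polynomial.X * Polynomial.C (w j)) : S →ₐ[ℂ] Polynomial ℂ) = aeval w := by
      ext j; simp
    rw [RingHom.coe_coe, ← h2]
    simpa using h1
  · obtain ⟨i, hi⟩ := Function.ne_iff.1 hw
    have hm : (X i - C (w i) : S) ∈ lineIdeal w := by
      rw [h, RingHom.mem_ker]; simp
    rw [lineIdeal, RingHom.mem_ker] at hm
    have h1 := congrArg (Polynomial.eval 0) hm
    simp at h1
    exact hi h1

/-- A prime `P` containing `a` and strictly inside the ideal of the line contains a prime element
`π`, and `P ≠ (π)` because `a` is primitive. So `0 < (π) < P < lineIdeal w < ker (eval w)` would be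
a chain of length four in a ring of dimension three. -/
theorem lineIdeal_mem_minimalPrimes {a : Fin 3 → S} {n : ℕ} (ha : ∀ i, (a i).IsHomogeneous n)
    (hp : IsPrimitiveVector a) {w : Fin 3 → ℂ} (hw : w ≠ 0) (h : ∀ i, eval w (a i) = 0) :
    lineIdeal w ∈ (Ideal.span (Set.range a)).minimalPrimes := by
  have hle : Ideal.span (Set.range a) ≤ lineIdeal w := by
    rw [Ideal.span_le]
    rintro _ ⟨i, rfl⟩
    exact (mem_lineIdeal_of_isHomogeneous (ha i)).2 (h i)
  refine ⟨⟨inferInstance, hle⟩, fun P ⟨hP, hPa⟩ hPw => ?_⟩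
  by_contra hne
  have hlt : P < lineIdeal w := lt_of_le_not_ge hPw hne
  have hPb : P ≠ ⊥ := by
    rintro rfl
    obtain ⟨i, hi⟩ := hp.exists_ne_zero
    exact hi (by simpa using hPa (Ideal.subset_span ⟨i, rfl⟩))
  obtain ⟨π, hπP, hπ⟩ := hP.exists_mem_prime_of_ne_bot hPb
  have hπprime : (Ideal.span {π}).IsPrime := (Ideal.span_singleton_prime hπ.ne_zero).2 hπ
  have h1 : (⊥ : Ideal S) < Ideal.span {π} :=
    bot_lt_iff_ne_bot.2 (by simpa using hπ.ne_zero)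
  have h2 : Ideal.span {π} < P := by
    refine lt_of_le_of_ne ((Ideal.span_singleton_le_iff_mem _).2 hπP) ?_
    rintro rfl
    obtain ⟨i, hi⟩ := hp π hπ
    exact hi (Ideal.mem_span_singleton.1 (hPa (Ideal.subset_span ⟨i, rfl⟩)))
  have hm : (RingHom.ker (eval w : S →+* ℂ)).IsPrime := RingHom.ker_isPrime _
  have hb : (⊥ : Ideal S).IsPrime := Ideal.isPrime_bot
  have e1 := Ideal.height_add_one_le_of_lt_of_isPrime h1
  have e2 := Ideal.height_add_one_le_of_lt_of_isPrime h2
  have e3 := Ideal.height_add_one_le_of_lt_of_isPrime hlt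
  have e4 := Ideal.height_add_one_le_of_lt_of_isPrime (lineIdeal_lt_pointIdeal hw)
  have e5 := Ideal.height_le_ringKrullDim_of_isPrime (I := RingHom.ker (eval w : S →+* ℂ))
  rw [MvPolynomial.ringKrullDim_of_isNoetherianRing] at e5
  have e6 : (4 : ℕ∞) ≤ (RingHom.ker (eval w : S →+* ℂ)).height := by
    refine le_trans ?_ e4
    refine le_trans ?_ (add_le_add_left e3 1)
    refine le_trans ?_ (add_le_add_left (add_le_add_left e2 1) 1)
    refine le_trans ?_ (add_le_add_left (add_le_add_left (add_le_add_left e1 1) 1) 1)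
    norm_num [add_assoc]
  have e7 : ((4 : ℕ∞) : WithBot ℕ∞) ≤ _ := (WithBot.coe_le_coe.2 e6).trans e5
  simp at e7
  exact absurd e7 (by decide)

/-- Distinct points give distinct minimal primes of the ideal `(a)`, and a Noetherian ring has only
finitely many of them. -/
theorem finite_zeros {a : Fin 3 → S} {n : ℕ} (ha : ∀ i, (a i).IsHomogeneous n)
    (hp : IsPrimitiveVector a) : {p : Plane | ∀ i, eval p.rep (a i) = 0}.Finite := by
  have hfin : ((fun p : Plane => lineIdeal p.rep) '' {p | ∀ i, eval p.rep (a i) = 0}).Finite := by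
    refine ((Ideal.span (Set.range a)).finite_minimalPrimes_of_isNoetherianRing).subset ?_
    rintro _ ⟨p, hp', rfl⟩
    exact lineIdeal_mem_minimalPrimes ha hp p.rep_nonzero hp'
  refine Set.Finite.of_finite_image hfin ?_
  intro p _ q _ h
  · have hpar := parallel_of_lineIdeal_eq h
    rw [← p.mk_rep, ← q.mk_rep, Projectivization.mk_eq_mk_iff']
    obtain ⟨i, hi⟩ := Function.ne_iff.1 q.rep_nonzero
    refine ⟨p.rep i / q.rep i, funext fun j => ?_⟩
    have := hpar i j
    simp only [Pi.smul_apply, smul_eq_mul]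
    rw [div_mul_eq_mul_div, div_eq_iff hi, hpar]

/-- The linear form with coefficients `c`. -/
noncomputable def linearForm (c : Fin 3 → ℂ) : S := ∑ i, C (c i) * X i

theorem isHomogeneous_linearForm (c : Fin 3 → ℂ) : (linearForm c).IsHomogeneous 1 :=
  IsHomogeneous.sum _ _ _ fun i _ => (isHomogeneous_X ℂ i).C_mul _

theorem eval_linearForm (c w : Fin 3 → ℂ) : eval w (linearForm c) = ∑ i, c i * w i := by
  simp [linearForm]

/-- A linear form, monic in the first variable, that avoids finitely many points. -/
theorem exists_linearForm (Z : Set Plane) (hZ : Z.Finite) :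
    ∃ c : Fin 3 → ℂ, c 0 = 1 ∧ ∀ p ∈ Z, eval p.rep (linearForm c) ≠ 0 := by
  have := hZ.to_subtype
  -- The extra index `none` carries the first basis vector, so that `g` can be rescaled to have
  -- first coefficient `1`.
  obtain ⟨g, hg⟩ := Module.exists_dual_forall_apply_ne_zero (K := ℂ)
    (fun o : Option Z => o.elim (Pi.single 0 1 : Fin 3 → ℂ) fun p => p.1.rep) (by
      rintro (_ | p)
      · simp
      · exact p.1.rep_nonzero)
  have hg0 := hg none
  simp only [Option.elim_none] at hg0
  refine ⟨fun i => g (Pi.single i 1) / g (Pi.single 0 1), div_self hg0, fun p hp => ?_⟩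
  have h1 := hg (some ⟨p, hp⟩)
  simp only [Option.elim_some] at h1
  rw [eval_linearForm]
  have h2 : g p.rep = ∑ i, g (Pi.single i 1) * p.rep i := by
    conv_lhs => rw [pi_eq_sum_univ' p.rep]
    simp [mul_comm]
  simp only [div_mul_eq_mul_div]
  rw [← Finset.sum_div, ← h2]
  exact div_ne_zero h1 hg0

/-- A nonzero common zero gives a point of the plane. -/
theorem exists_plane_zero {a : Fin 3 → S} {n : ℕ} (ha : ∀ i, (a i).IsHomogeneous n)
    {w : Fin 3 → ℂ} (hw : w ≠ 0) (h : ∀ i, eval w (a i) = 0) :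
    ∃ p : Plane, (∀ i, eval p.rep (a i) = 0) ∧ ∃ t : ℂ, t ≠ 0 ∧ p.rep = t • w := by
  obtain ⟨t, ht⟩ := Projectivization.exists_smul_eq_mk_rep ℂ w hw
  refine ⟨Projectivization.mk ℂ w hw, fun i => ?_, t, t.ne_zero, ht.symm⟩
  rw [← ht, Units.smul_def, eval_smul_of_isHomogeneous (ha i), h, mul_zero]

/-- If the linear form `ℓ` does not vanish on the zero set of the forms `a i`, then the ideal
`(a, ℓ)` contains all forms of large degree. -/
theorem exists_forms_le {a : Fin 3 → S} {n : ℕ} (ha : ∀ i, (a i).IsHomogeneous n) {c : Fin 3 → ℂ}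
    (hc : ∀ p : Plane, (∀ i, eval p.rep (a i) = 0) → eval p.rep (linearForm c) ≠ 0) :
    ∃ N, ∀ k ≥ N, ∀ F : S, F.IsHomogeneous k →
      F ∈ Ideal.span (Set.range a) ⊔ Ideal.span {linearForm c} := by
  set I := Ideal.span (Set.range a) ⊔ Ideal.span {linearForm c} with hI
  have hz : zeroLocus ℂ I ⊆ {0} := by
    intro w hw
    by_contra hne
    have h1 : ∀ i, eval w (a i) = 0 := fun i => by
      simpa [coe_aeval_eq_eval] using
        hw (a i) (Ideal.mem_sup_left (Ideal.subset_span ⟨i, rfl⟩))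
    obtain ⟨p, hp, t, ht, htw⟩ := exists_plane_zero ha hne h1
    refine hc p hp ?_
    have h2 : eval w (linearForm c) = 0 := by
      simpa [coe_aeval_eq_eval] using
        hw (linearForm c) (Ideal.mem_sup_right (Ideal.subset_span rfl))
    rw [htw, eval_smul_of_isHomogeneous (isHomogeneous_linearForm c), h2, mul_zero]
  -- Nullstellensatz: the only possible zero of `I` is the origin, so the irrelevant ideal lies in
  -- the radical and one of its powers lies in `I`.
  have hrad : Ideal.span (Set.range (X : Fin 3 → S)) ≤ I.radical := by
    rw [← vanishingIdeal_zeroLocus_eq_radical (K := ℂ), Ideal.span_le]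
    rintro _ ⟨i, rfl⟩
    intro w hw
    have : w = 0 := hz hw
    simp [this]
  obtain ⟨N, hN⟩ := Ideal.exists_pow_le_of_le_radical_of_fg hrad
    (IsNoetherian.noetherian _)
  refine ⟨N, fun k hk F hF => hN (Ideal.pow_le_pow_right hk ?_)⟩
  rw [Ideal.mem_span_pow_iff_exists_isHomogeneous]
  exact ⟨map C F, hF.map C, by rw [eval_map]; exact eval₂_eta F⟩

/-! ### Affine sections of graded ideals -/

section AffineSection

variable {I : Ideal S} {ℓ : S}

theorem exists_sub_mul_mem (hI : IsGradedIdeal I) (hℓ : ℓ.IsHomogeneous 1) {F : S} {k : ℕ}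
    (hF : F.IsHomogeneous (k + 1)) (h : F ∈ I ⊔ Ideal.span {ℓ}) :
    ∃ G : S, G.IsHomogeneous k ∧ F - ℓ * G ∈ I := by
  obtain ⟨j, hj, y, hy, hjy⟩ := Submodule.mem_sup.1 h
  obtain ⟨g, rfl⟩ := Ideal.mem_span_singleton.1 hy
  refine ⟨homogeneousComponent k g, homogeneousComponent_isHomogeneous _ _, ?_⟩
  have h1 := congrArg (homogeneousComponent (k + 1)) hjy
  rw [homogeneousComponent_eq_self hF, map_add, add_comm k 1,
    homogeneousComponent_homogeneous_mul hℓ] at h1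
  rw [← h1, add_sub_cancel_right]
  exact hI j hj _

/-- From degree `N - 1` on, multiplication by `ℓ` is surjective between consecutive degrees of `S /
I`; this is its `t`-fold iteration. -/
theorem exists_sub_pow_mul_mem (hI : IsGradedIdeal I) (hℓ : ℓ.IsHomogeneous 1) {N : ℕ}
    (hN : ∀ k ≥ N, ∀ F : S, F.IsHomogeneous k → F ∈ I ⊔ Ideal.span {ℓ}) {k : ℕ} (hk : N ≤ k + 1)
    (t : ℕ) : ∀ F : S, F.IsHomogeneous (k + t) → ∃ G : S, G.IsHomogeneous k ∧ F - ℓ ^ t * G ∈ I := by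
  induction t with
  | zero => exact fun F hF => ⟨F, hF, by simp⟩
  | succ t ih =>
    intro F hF
    obtain ⟨G, hG, hFG⟩ := exists_sub_mul_mem hI hℓ (k := k + t) hF (hN _ (by omega) F hF)
    obtain ⟨H, hH, hGH⟩ := ih G hG
    refine ⟨H, hH, ?_⟩
    have : F - ℓ ^ (t + 1) * H = (F - ℓ * G) + ℓ * (G - ℓ ^ t * H) := by ring
    rw [this]
    exact add_mem hFG (I.mul_mem_left _ hGH)

/-- Write `F = j + (ℓ - 1) g` with `j ∈ I` and compare components. Modulo `I`, the components of `g`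
vanish below degree `k`, equal `-F` in degree `k`, and are multiplied by `ℓ` at each later degree.
Since `g` is a polynomial, `ℓ ^ t * F` eventually lies in `I`. -/
theorem exists_pow_mul_mem_of_mem_sup (hI : IsGradedIdeal I) (hℓ : ℓ.IsHomogeneous 1) {F : S}
    {k : ℕ} (hF : F.IsHomogeneous k) (h : F ∈ I ⊔ Ideal.span {ℓ - 1}) : ∃ t, ℓ ^ t * F ∈ I := by
  obtain ⟨j, hj, y, hy, hjy⟩ := Submodule.mem_sup.1 h
  obtain ⟨g, rfl⟩ := Ideal.mem_span_singleton.1 hy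
  have hc : ∀ i, homogeneousComponent i F + homogeneousComponent i g -
      homogeneousComponent i (ℓ * g) ∈ I := fun i => by
    have : homogeneousComponent i F = homogeneousComponent i j + homogeneousComponent i (ℓ * g)
        - homogeneousComponent i g := by
      rw [← hjy, sub_mul, one_mul, map_add, map_sub]; ring
    rw [this, sub_add_cancel, add_sub_cancel_right]
    exact hI j hj i
  have hlow : ∀ i < k, homogeneousComponent i g ∈ I := by
    intro i
    induction i with
    | zero =>
      intro hi
      have := hc 0
      rwa [homogeneousComponent_homogeneous_mul_of_lt hℓ _ one_pos, sub_zero,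
        homogeneousComponent_of_mem hF, if_neg hi.ne, zero_add] at this
    | succ i ih =>
      intro hi
      have := hc (1 + i)
      rw [homogeneousComponent_homogeneous_mul hℓ,
        homogeneousComponent_of_mem hF, if_neg (by omega), zero_add] at this
      rw [add_comm]
      exact (Submodule.sub_mem_iff_left _ (I.mul_mem_left _ (ih (by omega)))).1 this
  have hk : F + homogeneousComponent k g ∈ I := by
    have h1 := hc k
    rw [homogeneousComponent_eq_self hF] at h1
    refine (Submodule.sub_mem_iff_left _ ?_).1 h1
    rcases k with _ | k
    · rw [homogeneousComponent_homogeneous_mul_of_lt hℓ _ one_pos]; exact zero_mem _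
    · rw [add_comm, homogeneousComponent_homogeneous_mul hℓ]
      exact I.mul_mem_left _ (hlow k (by omega))
  have hhigh : ∀ t, ℓ ^ t * F + homogeneousComponent (k + t) g ∈ I := by
    intro t
    induction t with
    | zero => simpa using hk
    | succ t ih =>
      have h1 := hc (1 + (k + t))
      rw [homogeneousComponent_homogeneous_mul hℓ,
        homogeneousComponent_of_mem hF, if_neg (by omega), zero_add] at h1
      have h2 := add_mem h1 (I.mul_mem_left ℓ ih)
      convert h2 using 1
      rw [show k + (t + 1) = 1 + (k + t) by ring]
      ring
  refine ⟨g.totalDegree + 1, ?_⟩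
  have := hhigh (g.totalDegree + 1)
  rwa [homogeneousComponent_eq_zero _ g (by omega), add_zero] at this

/-- The ascending chain of colon ideals `(I : ℓ ^ t)` is stationary. -/
theorem exists_uniform_pow_mul_mem (I : Ideal S) (ℓ : S) :
    ∃ T, ∀ (F : S) (t : ℕ), ℓ ^ t * F ∈ I → ℓ ^ T * F ∈ I := by
  let K : ℕ →o Ideal S :=
    ⟨fun t => Submodule.comap (LinearMap.mulLeft S (ℓ ^ t)) I, fun s t hst F hF => by
      rw [Submodule.mem_comap, LinearMap.mulLeft_apply] at hF ⊢
      rw [← Nat.sub_add_cancel hst, pow_add, mul_assoc]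
      exact I.mul_mem_left _ hF⟩
  obtain ⟨T, hT⟩ := monotone_stabilizes_iff_noetherian.2 (inferInstance : IsNoetherian S S) K
  refine ⟨T, fun F t ht => ?_⟩
  have h1 : F ∈ K (max t T) := K.monotone (le_max_left t T) ht
  rw [← hT _ (le_max_right _ _)] at h1
  exact h1

theorem pow_mul_sub_mem_span (ℓ F : S) (t : ℕ) : ℓ ^ t * F - F ∈ Ideal.span {ℓ - 1} := by
  rw [Ideal.mem_span_singleton]
  have := sub_dvd_pow_sub_pow ℓ 1 t
  rw [one_pow] at this
  have h2 := this.mul_right F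
  rwa [sub_mul, one_mul] at h2

/-- On the plane `ℓ = 1` a homogeneous component may be multiplied by powers of `ℓ` to reach degree
`k` from below, and divided by them modulo `I` to reach it from above. -/
theorem exists_form_sub_mem (hI : IsGradedIdeal I) (hℓ : ℓ.IsHomogeneous 1) {N : ℕ}
    (hN : ∀ k ≥ N, ∀ F : S, F.IsHomogeneous k → F ∈ I ⊔ Ideal.span {ℓ}) {k : ℕ} (hk : N ≤ k)
    (F : S) : ∃ G : S, G.IsHomogeneous k ∧ F - G ∈ I ⊔ Ideal.span {ℓ - 1} := by
  have hom : ∀ j, ∀ F : S, F.IsHomogeneous j →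
      ∃ G : S, G.IsHomogeneous k ∧ F - G ∈ I ⊔ Ideal.span {ℓ - 1} := by
    intro j F hF
    rcases le_or_gt j k with hjk | hjk
    · have hG : (ℓ ^ (k - j) * F).IsHomogeneous k := by
        have := (hℓ.pow (k - j)).mul hF
        rwa [one_mul, Nat.sub_add_cancel hjk] at this
      refine ⟨ℓ ^ (k - j) * F, hG, ?_⟩
      rw [← neg_sub (ℓ ^ (k - j) * F) F]
      exact neg_mem (Ideal.mem_sup_right (pow_mul_sub_mem_span ℓ F (k - j)))
    · obtain ⟨t, rfl⟩ := Nat.exists_eq_add_of_le hjk.le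
      obtain ⟨G, hG, hFG⟩ := exists_sub_pow_mul_mem hI hℓ hN (by omega) t F hF
      refine ⟨G, hG, ?_⟩
      rw [← sub_add_sub_cancel F (ℓ ^ t * G) G]
      exact add_mem (Ideal.mem_sup_left hFG) (Ideal.mem_sup_right (pow_mul_sub_mem_span _ _ _))
  choose G hG hFG using fun j => hom j _ (homogeneousComponent_isHomogeneous j F)
  refine ⟨∑ j ∈ Finset.range (F.totalDegree + 1), G j, IsHomogeneous.sum _ _ _ fun j _ => hG j, ?_⟩
  have : F - ∑ j ∈ Finset.range (F.totalDegree + 1), G j =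
      ∑ j ∈ Finset.range (F.totalDegree + 1), (homogeneousComponent j F - G j) := by
    rw [Finset.sum_sub_distrib, sum_homogeneousComponent]
  rw [this]
  exact Ideal.sum_mem _ fun j _ => hFG j

/-- The coordinate ring of the section of the cone of `I` by the affine plane `ℓ = 1`. -/
abbrev AffineSection (I : Ideal S) (ℓ : S) : Type := S ⧸ (I ⊔ Ideal.span {ℓ - 1})

/-- For large `k`, restriction to the plane `ℓ = 1` maps the forms of degree `k` onto the section,
with kernel exactly the degree `k` part of `I`. -/
theorem finrank_affineSection (hI : IsGradedIdeal I) (hℓ : ℓ.IsHomogeneous 1) {N : ℕ}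
    (hN : ∀ k ≥ N, ∀ F : S, F.IsHomogeneous k → F ∈ I ⊔ Ideal.span {ℓ}) :
    Module.Finite ℂ (AffineSection I ℓ) ∧ ∃ K, ∀ k ≥ K,
      Module.finrank ℂ (gradedPiece I k) + Module.finrank ℂ (AffineSection I ℓ) =
        (k + 2).choose 2 := by
  set q : S →ₗ[ℂ] AffineSection I ℓ := (Ideal.Quotient.mkₐ ℂ (I ⊔ Ideal.span {ℓ - 1})).toLinearMap
    with hq
  have hq0 : ∀ F, q F = 0 ↔ F ∈ I ⊔ Ideal.span {ℓ - 1} := fun F => Ideal.Quotient.eq_zero_iff_mem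
  have hsurj : ∀ k ≥ N, (forms k).map q = ⊤ := by
    intro k hk
    rw [eq_top_iff]
    rintro x -
    obtain ⟨F, rfl⟩ := Ideal.Quotient.mk_surjective x
    obtain ⟨G, hG, hFG⟩ := exists_form_sub_mem hI hℓ hN hk F
    exact ⟨G, hG, (Ideal.Quotient.eq.2 hFG).symm⟩
  refine ⟨Module.finite_def.2 (hsurj N le_rfl ▸ (homogeneousSubmodule_fg _ _ N).map q), ?_⟩
  obtain ⟨T, hT⟩ := exists_uniform_pow_mul_mem I ℓ
  refine ⟨N + T, fun k hk => ?_⟩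
  have h1 := finrank_map_add_finrank_inf_ker q (forms k)
  rw [hsurj k (by omega), finrank_top, finrank_forms] at h1
  have h2 : forms k ⊓ LinearMap.ker q = gradedPiece I k := by
    ext F
    rw [Submodule.mem_inf, LinearMap.mem_ker, hq0, mem_gradedPiece, mem_homogeneousSubmodule,
      and_comm]
    refine and_congr_left fun hF => ⟨fun h => ?_, fun h => Ideal.mem_sup_left h⟩
    -- Since `ℓ` may be a zero divisor modulo `I`, it cannot simply be cancelled. Writing `F` as `ℓ
    -- ^ T * G` modulo `I` reduces the exponent `t + T` to the uniform exponent `T`, which recovers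
    -- `F`.
    obtain ⟨t, ht⟩ := exists_pow_mul_mem_of_mem_sup hI hℓ hF h
    obtain ⟨s, rfl⟩ := Nat.exists_eq_add_of_le (show T ≤ k by omega)
    rw [add_comm] at hF
    obtain ⟨G, hG, hFG⟩ := exists_sub_pow_mul_mem hI hℓ hN (by omega) T F hF
    have h3 : ℓ ^ (t + T) * G ∈ I := by
      have h4 := I.mul_mem_left (ℓ ^ t) hFG
      rw [mul_sub, ← mul_assoc, ← pow_add] at h4
      exact (Submodule.sub_mem_iff_right _ ht).1 h4
    have h5 := add_mem hFG (hT G _ h3)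
    rwa [sub_add_cancel] at h5
  rw [h2] at h1
  rw [add_comm, h1]

end AffineSection

/-! ### Local rings at rational points -/

section LocalRing

variable {R : Type*} [CommRing R] [Algebra ℂ R] {ε : R →ₐ[ℂ] ℂ} {𝔭 : Ideal R} [𝔭.IsPrime]

theorem exists_localization_lift (h : ∀ r, r ∈ 𝔭 ↔ ε r = 0) {T : Type*} [CommRing T] [Algebra ℂ T]
    (φ : R →ₐ[ℂ] T) (hφ : ∀ r, ε r ≠ 0 → IsUnit (φ r)) :
    ∃ ψ : Localization.AtPrime 𝔭 →ₐ[ℂ] T, ∀ r, ψ (algebraMap R _ r) = φ r :=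
  ⟨IsLocalization.liftAlgHom (M := 𝔭.primeCompl) (f := φ)
    fun y => hφ y fun h0 => y.2 ((h y).2 h0), fun r => by simp⟩

/-- At a rational point, evaluation extends to the local ring and detects its units. -/
theorem exists_localization_eval (h : ∀ r, r ∈ 𝔭 ↔ ε r = 0) :
    ∃ ev : Localization.AtPrime 𝔭 →ₐ[ℂ] ℂ, (∀ r, ev (algebraMap R _ r) = ε r) ∧
      ∀ y, ev y ≠ 0 → IsUnit y := by
  obtain ⟨ev, hev⟩ := exists_localization_lift h ε fun r hr => isUnit_iff_ne_zero.2 hr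
  refine ⟨ev, hev, fun y hy => ?_⟩
  obtain ⟨⟨r, s⟩, hrs⟩ := IsLocalization.surj 𝔭.primeCompl y
  have hr : r ∉ 𝔭 := by
    intro hr
    have h1 := congrArg ev hrs
    rw [map_mul, hev, hev, (h r).1 hr, mul_eq_zero] at h1
    exact s.2 ((h s).2 (h1.resolve_left hy))
  have h2 : IsUnit (algebraMap R (Localization.AtPrime 𝔭) r) :=
    IsLocalization.map_units _ (⟨r, hr⟩ : 𝔭.primeCompl)
  rw [← hrs] at h2
  exact isUnit_of_mul_isUnit_left h2

theorem localization_algHom_ext {T : Type*} [CommRing T] [Algebra ℂ T]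
    {φ ψ : Localization.AtPrime 𝔭 →ₐ[ℂ] T}
    (h : ∀ r, φ (algebraMap R _ r) = ψ (algebraMap R _ r)) : φ = ψ := by
  apply AlgHom.coe_ringHom_injective
  apply IsLocalization.ringHom_ext 𝔭.primeCompl
  ext r
  exact h r

end LocalRing

/-! ### Charts -/

/-- The homogeneous coordinates of the points of the `i`-th affine chart. -/
noncomputable def chartCoord (i : Fin 3) : Fin 3 → MvPolynomial (Fin 2) ℂ :=
  i.insertNth (1 : MvPolynomial (Fin 2) ℂ) X

theorem chartCoord_self (i : Fin 3) : chartCoord i i = 1 := by simp [chartCoord]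

theorem chartCoord_succAbove (i : Fin 3) (j : Fin 2) : chartCoord i (i.succAbove j) = X j := by
  simp [chartCoord]

theorem dehomogenize_eq (i : Fin 3) (F : S) : dehomogenize i F = aeval (chartCoord i) F := rfl

theorem pderiv_dehomogenize (i : Fin 3) (j : Fin 2) (F : S) :
    pderiv j (dehomogenize i F) = dehomogenize i (pderiv (i.succAbove j) F) := by
  simp only [dehomogenize_eq]
  induction F using MvPolynomial.induction_on with
  | C a => simp
  | add p q hp hq => rw [map_add, map_add, map_add, map_add, hp, hq]
  | mul_X p k hp =>
    rw [map_mul, pderiv_mul, pderiv_mul, map_add, map_mul, map_mul, hp, aeval_X]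
    congr 2
    rcases Fin.eq_self_or_eq_succAbove i k with rfl | ⟨k, rfl⟩
    · rw [chartCoord_self, pderiv_X_of_ne (Fin.succAbove_ne k j).symm]; simp
    · rw [chartCoord_succAbove, pderiv_X, pderiv_X]
      by_cases h : k = j
      · subst h; simp
      · rw [Pi.single_eq_of_ne h, Pi.single_eq_of_ne (fun e => h (Fin.succAbove_right_injective e)),
          map_zero]

/-- The Jacobian ideal `(f_x, f_y, f_z)`. -/
noncomputable def jacobianIdeal (f : S) : Ideal S := Ideal.span (Set.range fun i => pderiv i f)

theorem IsReducedCurve.mem_jacobianIdeal {d : ℕ} {f : S} (hf : IsReducedCurve d f) (hd : 0 < d) :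
    f ∈ jacobianIdeal f := by
  have h0 : (d : S) * f ∈ jacobianIdeal f := by
    rw [← hf.euler]
    exact Ideal.sum_mem _ fun i _ => Ideal.mul_mem_left _ _ (Ideal.subset_span ⟨i, rfl⟩)
  have h1 : (C ((d : ℂ)⁻¹) : S) * ((d : S) * f) = f := by
    have : (d : S) = C (d : ℂ) := by simp
    rw [this, ← mul_assoc, ← C_mul, inv_mul_cancel₀ (by exact_mod_cast hd.ne'), C_1, one_mul]
  have h2 := Ideal.mul_mem_left _ (C ((d : ℂ)⁻¹)) h0
  rwa [h1] at h2

/-- Two of the partials of `f` restrict to the partials of the affine equation. The third is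
recovered from Euler's relation, in which the coordinate of the chart equals `1`. -/
theorem IsReducedCurve.dehomogenize_pderiv_mem {d : ℕ} {f : S} (hf : IsReducedCurve d f)
    (i k : Fin 3) : dehomogenize i (pderiv k f) ∈ Ideal.span {dehomogenize i f,
      pderiv 0 (dehomogenize i f), pderiv 1 (dehomogenize i f)} := by
  set I := Ideal.span {dehomogenize i f, pderiv 0 (dehomogenize i f), pderiv 1 (dehomogenize i f)}
    with hI
  have hs : ∀ j, dehomogenize i (pderiv (i.succAbove j) f) ∈ I := by
    intro j
    rw [← pderiv_dehomogenize]
    apply Ideal.subset_span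
    fin_cases j <;> simp
  rcases Fin.eq_self_or_eq_succAbove i k with rfl | ⟨j, rfl⟩
  · have h1 := congrArg (dehomogenize k) hf.euler
    rw [Fin.sum_univ_succAbove _ k] at h1
    simp only [dehomogenize_eq, map_add, map_mul, map_sum, aeval_X, chartCoord_self, one_mul,
      map_natCast] at h1
    rw [dehomogenize_eq, eq_sub_of_add_eq h1]
    refine sub_mem (I.mul_mem_left _ (Ideal.subset_span (by simp [dehomogenize_eq]))) ?_
    exact I.sum_mem fun j _ => I.mul_mem_left _ (hs j)
  · exact hs j

/-! ### Local Tjurina algebras as localizations of an affine section -/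

theorem aeval_comp_eq {σ τ A : Type*} [CommRing A] [Algebra ℂ A] (φ : MvPolynomial τ ℂ →ₐ[ℂ] A)
    (x : σ → MvPolynomial τ ℂ) (F : MvPolynomial σ ℂ) :
    φ (aeval x F) = aeval (fun j => φ (x j)) F := by
  rw [← AlgHom.comp_apply]
  congr 1
  ext j; simp

theorem map_eval_point {σ A : Type*} [CommRing A] [Algebra ℂ A] (ε : A →ₐ[ℂ] ℂ)
    (x : σ → A) (F : MvPolynomial σ ℂ) : ε (aeval x F) = eval (fun j => ε (x j)) F := by
  rw [← AlgHom.comp_apply, ← aeval_eq_eval]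
  congr 1
  ext j; simp

/-- The Tjurina algebra at the point with homogeneous coordinates `v`, computed in the `i`-th chart,
has the dimension of the local ring, at the multiple of `v` where `ℓ = 1`, of the section `ℓ = 1`
of the cone of the Jacobian ideal. -/
theorem affineTjurina_eq_finrank {d : ℕ} {f : S} (hf : IsReducedCurve d f) (hd : 0 < d)
    {ℓ : S} (hℓ : ℓ.IsHomogeneous 1) {v : Fin 3 → ℂ} {i : Fin 3} (hi : v i ≠ 0)
    (hv : eval v ℓ ≠ 0) (𝔪 : Ideal (AffineSection (jacobianIdeal f) ℓ)) [𝔪.IsPrime]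
    {ε : AffineSection (jacobianIdeal f) ℓ →ₐ[ℂ] ℂ}
    (hε : ∀ j, ε (Ideal.Quotient.mk _ (X j)) = v j / eval v ℓ)
    (h𝔪 : ∀ r, r ∈ 𝔪 ↔ ε r = 0) :
    affineTjurina (dehomogenize i f) (fun j => v (i.succAbove j) / v i) =
      Module.finrank ℂ (Localization.AtPrime 𝔪) := by
  set g := dehomogenize i f with hg
  set a : Fin 2 → ℂ := fun j => v (i.succAbove j) / v i with ha
  set T := Ideal.span {g, pderiv 0 g, pderiv 1 g} with hT
  -- the local ring `O` of the affine plane and its quotient `D`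
  have hpt : ∀ r, r ∈ pointIdeal a ↔ aeval (R := ℂ) a r = 0 := fun r => Iff.rfl
  obtain ⟨evO, hevO, hunitO⟩ := exists_localization_eval (𝔭 := pointIdeal a) hpt
  obtain ⟨evB, hevB, hunitB⟩ := exists_localization_eval h𝔪
  let ιO : MvPolynomial (Fin 2) ℂ →ₐ[ℂ] LocalRingAt a := Algebra.algHom ℂ _ _
  let π : LocalRingAt a →ₐ[ℂ] LocalRingAt a ⧸ tjurinaIdeal g a := Ideal.Quotient.mkₐ ℂ _
  let ιB : AffineSection (jacobianIdeal f) ℓ →ₐ[ℂ] Localization.AtPrime 𝔪 := Algebra.algHom ℂ _ _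
  let q : S →ₐ[ℂ] AffineSection (jacobianIdeal f) ℓ := Ideal.Quotient.mkₐ ℂ _
  let y : Fin 3 → Localization.AtPrime 𝔪 := fun j => ιB (q (X j))
  have hιB : ∀ r, ιB r = algebraMap _ _ r := fun r => rfl
  have hιO : ∀ r, ιO r = algebraMap _ _ r := fun r => rfl
  have haq : ∀ F, aeval y F = ιB (q F) := fun F => by
    have : (aeval y : S →ₐ[ℂ] _) = ιB.comp q := by
      ext j; simp [y]
    rw [this]; rfl
  have hq0 : ∀ F ∈ jacobianIdeal f, q F = 0 := fun F hF =>
    Ideal.Quotient.eq_zero_iff_mem.2 (Ideal.mem_sup_left hF)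
  have hqℓ : q ℓ = 1 := by
    rw [← sub_eq_zero, ← map_one q, ← map_sub]
    exact Ideal.Quotient.eq_zero_iff_mem.2 (Ideal.mem_sup_right (Ideal.subset_span rfl))
  have hac : ∀ j, aeval (R := ℂ) a (chartCoord i j) = (v i)⁻¹ * v j := fun j => by
    rcases Fin.eq_self_or_eq_succAbove i j with rfl | ⟨j, rfl⟩
    · rw [chartCoord_self, map_one, inv_mul_cancel₀ hi]
    · rw [chartCoord_succAbove, aeval_X]; exact div_eq_inv_mul _ _
  -- the map from the section to the Tjurina algebra
  set L := ιO (dehomogenize i ℓ) with hL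
  have hevL : evO L = (v i)⁻¹ * eval v ℓ := by
    rw [hL, hιO, hevO, dehomogenize_eq, map_eval_point]
    simp only [hac]
    have := eval_smul_of_isHomogeneous hℓ (v i)⁻¹ v
    rw [pow_one] at this
    exact this
  obtain ⟨Li, hLi⟩ := (hunitO L (by
    rw [hevL]; exact mul_ne_zero (inv_ne_zero hi) hv)).exists_right_inv
  have hevLi : evO Li = v i / eval v ℓ := by
    have h1 := congrArg evO hLi
    rw [map_mul, map_one, hevL] at h1
    field_simp at h1 ⊢
    linear_combination h1
  -- Dividing the homogeneous coordinates of the chart by `ℓ`, a unit near the point, moves them to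
  -- the plane `ℓ = 1`.
  let ΨS : S →ₐ[ℂ] LocalRingAt a := aeval fun j => Li * ιO (chartCoord i j)
  have hΨS : ∀ {F : S} {k : ℕ}, F.IsHomogeneous k → ΨS F = Li ^ k * ιO (dehomogenize i F) :=
    fun {F k} hF => by
      rw [dehomogenize_eq, aeval_comp_eq]
      exact aeval_mul_of_isHomogeneous hF _ _
  have hπ0 : ∀ P ∈ T, π (ιO P) = 0 := fun P hP =>
    Ideal.Quotient.eq_zero_iff_mem.2 (Ideal.mem_map_of_mem _ hP)
  have hker : jacobianIdeal f ⊔ Ideal.span {ℓ - 1} ≤ RingHom.ker (π.comp ΨS) := by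
    refine sup_le (Ideal.span_le.2 ?_) (Ideal.span_le.2 ?_)
    · rintro _ ⟨k, rfl⟩
      change π (ΨS (pderiv k f)) = 0
      rw [hΨS hf.isHomogeneous.pderiv, map_mul, hπ0 _ (hf.dehomogenize_pderiv_mem i k), mul_zero]
    · rintro _ rfl
      change π (ΨS (ℓ - 1)) = 0
      rw [map_sub, hΨS hℓ, map_one, pow_one, mul_comm, hLi, sub_self, map_zero]
  let ΨA : AffineSection (jacobianIdeal f) ℓ →ₐ[ℂ] LocalRingAt a ⧸ tjurinaIdeal g a :=
    Ideal.Quotient.liftₐ _ (π.comp ΨS) fun F hF => hker hF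
  have hΨA : ∀ F, ΨA (q F) = π (ΨS F) := fun F => rfl
  have hΨu : ∀ r, ε r ≠ 0 → IsUnit (ΨA r) := fun r hr => by
    obtain ⟨F, rfl⟩ := Ideal.Quotient.mk_surjective r
    refine IsUnit.map π (hunitO (ΨS F) ?_)
    have h1 : ε (q F) = eval (fun j => v j / eval v ℓ) F := by
      rw [← aeval_X_left_apply F, aeval_comp_eq, map_eval_point]
      simp only [aeval_X_left_apply]
      congr 2
      exact funext hε
    have h2 : evO (ΨS F) = eval (fun j => v j / eval v ℓ) F := by
      rw [map_eval_point]
      congr 2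
      funext j
      rw [map_mul, hιO, hevO, hac, hevLi]
      field_simp
    rw [h2, ← h1]
    exact hr
  obtain ⟨Ψ, hΨ⟩ := exists_localization_lift (T := LocalRingAt a ⧸ tjurinaIdeal g a) h𝔪 ΨA hΨu
  -- the map from the Tjurina algebra to the section
  have hevy : ∀ j, evB (y j) = v j / eval v ℓ := fun j => by
    rw [← hε]; exact hevB _
  obtain ⟨yi, hyi⟩ := (hunitB (y i) (by rw [hevy]; exact div_ne_zero hi hv)).exists_right_inv
  have hevyi : evB yi = eval v ℓ / v i := by
    have h1 := congrArg evB hyi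
    rw [map_mul, map_one, hevy] at h1
    field_simp at h1 ⊢
    linear_combination h1
  -- The affine coordinates of the chart are the ratios of the coordinates on the section by the
  -- `i`-th one, a unit since `v i ≠ 0`.
  let Φ0 : MvPolynomial (Fin 2) ℂ →ₐ[ℂ] Localization.AtPrime 𝔪 :=
    aeval fun j => yi * y (i.succAbove j)
  have hΦ0c : ∀ j, Φ0 (chartCoord i j) = yi * y j := fun j => by
    rcases Fin.eq_self_or_eq_succAbove i j with rfl | ⟨j, rfl⟩
    · rw [chartCoord_self, map_one, mul_comm, hyi]
    · rw [chartCoord_succAbove]; exact aeval_X _ _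
  have hΦ0 : ∀ {F : S} {k : ℕ}, F.IsHomogeneous k →
      Φ0 (dehomogenize i F) = yi ^ k * ιB (q F) := fun {F k} hF => by
    rw [dehomogenize_eq, aeval_comp_eq (A := Localization.AtPrime 𝔪) Φ0]
    simp only [hΦ0c]
    rw [aeval_mul_of_isHomogeneous (A := Localization.AtPrime 𝔪) hF, haq]
  have hΦu : ∀ r, aeval (R := ℂ) a r ≠ 0 → IsUnit (Φ0 r) := fun r hr => by
    refine hunitB _ ?_
    rw [map_eval_point]
    have : (fun j => evB (yi * y (i.succAbove j))) = a := funext fun j => by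
      rw [map_mul, hevyi, hevy, ha]
      field_simp
    rw [this]
    exact hr
  obtain ⟨ΦO, hΦO⟩ := exists_localization_lift (T := Localization.AtPrime 𝔪) hpt Φ0 hΦu
  have hkerO : tjurinaIdeal g a ≤ RingHom.ker ΦO := by
    refine Ideal.map_le_iff_le_comap.2 (Ideal.span_le.2 ?_)
    have hJ : ∀ k, ιB (q (pderiv k f)) = 0 := fun k => by
      rw [hq0 _ (Ideal.subset_span ⟨k, rfl⟩), map_zero]
    intro P hP
    change ΦO (algebraMap _ _ P) = 0
    rw [hΦO]
    rcases hP with rfl | rfl | rfl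
    · rw [hg, hΦ0 hf.isHomogeneous, hq0 _ (hf.mem_jacobianIdeal hd), map_zero, mul_zero]
    · rw [hg, pderiv_dehomogenize, hΦ0 hf.isHomogeneous.pderiv, hJ, mul_zero]
    · rw [hg, pderiv_dehomogenize, hΦ0 hf.isHomogeneous.pderiv, hJ, mul_zero]
  let Φ : LocalRingAt a ⧸ tjurinaIdeal g a →ₐ[ℂ] Localization.AtPrime 𝔪 :=
    Ideal.Quotient.liftₐ _ ΦO fun F hF => hkerO hF
  have hΦ : ∀ z, Φ (π z) = ΦO z := fun z => rfl
  -- the two maps are inverse to each other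
  have h1 : Φ.comp Ψ = AlgHom.id ℂ _ := by
    refine localization_algHom_ext (𝔭 := 𝔪) (T := Localization.AtPrime 𝔪) fun r => ?_
    obtain ⟨F, rfl⟩ := Ideal.Quotient.mk_surjective r
    have h2 : ((Φ.comp Ψ).comp (ιB.comp q)) = ιB.comp q := by
      ext j
      change Φ (Ψ (ιB (q (X j)))) = y j
      rw [hιB, hΨ, hΨA, hΦ]
      -- Clearing the denominator `L` avoids computing the image of its inverse: `L` goes to `yi`,
      -- because `ℓ` is `1` on the section.
      have e1 : ΨS (X j) * L = ιO (chartCoord i j) := by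
        have : ΨS (X j) = Li * ιO (chartCoord i j) := aeval_X _ _
        rw [this]
        linear_combination (ιO (chartCoord i j)) * hLi
      have e2 := congrArg ΦO e1
      rw [map_mul, hL, hιO, hιO, hΦO, hΦO, hΦ0 hℓ, hqℓ, map_one, hΦ0c] at e2
      linear_combination (y i) * e2 + (y j - ΦO (ΨS (X j))) * hyi
    exact DFunLike.congr_fun h2 F
  have h2 : Ψ.comp Φ = AlgHom.id ℂ _ := by
    have h3 : (Ψ.comp Φ).comp π = π := by
      refine localization_algHom_ext (𝔭 := pointIdeal a)
        (T := LocalRingAt a ⧸ tjurinaIdeal g a) fun r => ?_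
      have h4 : ((Ψ.comp Φ).comp π).comp ιO = π.comp ιO := by
        ext j
        change Ψ (ΦO (ιO (X j))) = π (ιO (X j))
        rw [hιO, hΦO]
        have e1 : Φ0 (X j) * y i = y (i.succAbove j) := by
          have : Φ0 (X j) = yi * y (i.succAbove j) := aeval_X _ _
          rw [this]
          linear_combination (y (i.succAbove j)) * hyi
        have e2 := congrArg Ψ e1
        have e3 : ∀ k, Ψ (y k) = π (Li * ιO (chartCoord i k)) := fun k => by
          change Ψ (ιB (q (X k))) = _
          rw [hιB, hΨ, hΨA]
          congr 1
          exact aeval_X _ _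
        have e4 := congrArg π hLi
        rw [map_mul, e3, e3, chartCoord_self, chartCoord_succAbove, map_one, mul_one, map_mul] at e2
        rw [map_mul, map_one] at e4
        rw [hιO] at e2
        linear_combination (π L) * e2 + (π (algebraMap (MvPolynomial (Fin 2) ℂ) (LocalRingAt a) (X j)) - Ψ (Φ0 (X j))) * e4
      exact DFunLike.congr_fun h4 r
    refine AlgHom.ext fun z => ?_
    obtain ⟨o, rfl⟩ := Ideal.Quotient.mk_surjective z
    exact DFunLike.congr_fun h3 o
  exact (AlgEquiv.ofAlgHom Φ Ψ h1 h2).toLinearEquiv.finrank_eq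

/-! ### The total Tjurina number and the Jacobian ideal -/

theorem IsReducedCurve.singularPoints_eq {d : ℕ} {f : S} (hf : IsReducedCurve d f) (hd : 0 < d) :
    singularPoints f = {p | ∀ i, eval p.rep (pderiv i f) = 0} := by
  ext p
  refine ⟨fun h => h.2, fun h => ⟨?_, h⟩⟩
  have h1 := congrArg (eval p.rep) hf.euler
  simp only [map_sum, map_mul, h _, mul_zero, Finset.sum_const_zero, map_natCast] at h1
  exact (mul_eq_zero.1 h1.symm).resolve_left (by exact_mod_cast hd.ne')

/-- Evaluation at a point of the affine section. -/
noncomputable def sectionEval {I : Ideal S} {ℓ : S} (w : Fin 3 → ℂ)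
    (hw : ∀ F ∈ I ⊔ Ideal.span {ℓ - 1}, aeval (R := ℂ) w F = 0) : AffineSection I ℓ →ₐ[ℂ] ℂ :=
  Ideal.Quotient.liftₐ _ (aeval w) hw

theorem sectionEval_mk {I : Ideal S} {ℓ : S} (w : Fin 3 → ℂ)
    (hw : ∀ F ∈ I ⊔ Ideal.span {ℓ - 1}, aeval (R := ℂ) w F = 0) (F : S) :
    sectionEval w hw (Ideal.Quotient.mk _ F) = eval w F := rfl

theorem aeval_eq_zero_of_mem_section {f : S} {ℓ : S} {w : Fin 3 → ℂ}
    (h : ∀ i, eval w (pderiv i f) = 0) (hw : eval w ℓ = 1) :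
    ∀ F ∈ jacobianIdeal f ⊔ Ideal.span {ℓ - 1}, aeval (R := ℂ) w F = 0 := by
  have hle : jacobianIdeal f ⊔ Ideal.span {ℓ - 1} ≤ RingHom.ker (eval w : S →+* ℂ) := by
    refine sup_le (Ideal.span_le.2 ?_) (Ideal.span_le.2 ?_)
    · rintro _ ⟨i, rfl⟩
      exact h i
    · rintro _ rfl
      change eval w (ℓ - 1) = 0
      rw [map_sub, hw, map_one, sub_self]
  exact fun F hF => hle hF

/-- The section is Artinian, so its dimension is the sum of those of its localizations. Its primes
are the points of the cone with `ℓ = 1`, by the Nullstellensatz; they correspond to the singular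
points after scaling a representative to have `ℓ = 1`. -/
theorem totalTjurina_eq_finrank {d : ℕ} {f : S} (hf : IsReducedCurve d f) (hd : 0 < d)
    {ℓ : S} (hℓ : ℓ.IsHomogeneous 1)
    (hc : ∀ p : Plane, (∀ i, eval p.rep (pderiv i f) = 0) → eval p.rep ℓ ≠ 0)
    [Module.Finite ℂ (AffineSection (jacobianIdeal f) ℓ)] :
    totalTjurina f = Module.finrank ℂ (AffineSection (jacobianIdeal f) ℓ) := by
  have hart : IsArtinianRing (AffineSection (jacobianIdeal f) ℓ) := IsArtinianRing.of_finite ℂ _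
  have hfin : Fintype (PrimeSpectrum (AffineSection (jacobianIdeal f) ℓ)) := Fintype.ofFinite _
  rw [IsArtinianRing.finrank_eq_sum_primeSpectrum _ ℂ, totalTjurina, hf.singularPoints_eq hd,
    ← finsum_set_coe_eq_finsum_mem, ← finsum_eq_sum_of_fintype]
  have hn : ∀ p : {p : Plane | ∀ i, eval p.rep (pderiv i f) = 0},
      ∀ F ∈ jacobianIdeal f ⊔ Ideal.span {ℓ - 1},
        aeval (R := ℂ) ((eval p.1.rep ℓ)⁻¹ • p.1.rep) F = 0 := fun p =>
    aeval_eq_zero_of_mem_section (fun i => by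
      rw [eval_smul_of_isHomogeneous hf.isHomogeneous.pderiv, p.2 i, mul_zero]) (by
      rw [eval_smul_of_isHomogeneous hℓ, pow_one, inv_mul_cancel₀ (hc _ p.2)])
  refine finsum_eq_of_bijective
    (fun p => ⟨RingHom.ker (sectionEval _ (hn p)), RingHom.ker_isPrime _⟩) ⟨?_, ?_⟩ ?_
  · intro p q hpq
    have hker : RingHom.ker (sectionEval _ (hn p)) = RingHom.ker (sectionEval _ (hn q)) :=
      congrArg PrimeSpectrum.asIdeal hpq
    have hpt : ∀ j, (eval p.1.rep ℓ)⁻¹ * p.1.rep j = (eval q.1.rep ℓ)⁻¹ * q.1.rep j := by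
      intro j
      have h1 : Ideal.Quotient.mk _ (X j - C ((eval p.1.rep ℓ)⁻¹ * p.1.rep j)) ∈
          RingHom.ker (sectionEval _ (hn p)) := by
        rw [RingHom.mem_ker, sectionEval_mk]; simp
      rw [hker, RingHom.mem_ker, sectionEval_mk] at h1
      simp only [map_sub, eval_X, eval_C, Pi.smul_apply, smul_eq_mul, sub_eq_zero] at h1
      exact h1.symm
    apply Subtype.ext
    rw [← p.1.mk_rep, ← q.1.mk_rep, Projectivization.mk_eq_mk_iff']
    refine ⟨eval p.1.rep ℓ * (eval q.1.rep ℓ)⁻¹, funext fun j => ?_⟩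
    rw [Pi.smul_apply, smul_eq_mul, mul_assoc, ← hpt, mul_inv_cancel_left₀ (hc _ p.2)]
  · intro P
    have hmax : P.asIdeal.IsMaximal := inferInstance
    have hmax2 : (P.asIdeal.comap (Ideal.Quotient.mk _)).IsMaximal :=
      Ideal.comap_isMaximal_of_surjective _ Ideal.Quotient.mk_surjective
    obtain ⟨w, hw⟩ := (isMaximal_iff_eq_vanishingIdeal_singleton (K := ℂ)).1 hmax2
    have hmem : ∀ F : S, Ideal.Quotient.mk _ F ∈ P.asIdeal ↔ eval w F = 0 := by
      intro F
      rw [← Ideal.mem_comap, hw, mem_vanishingIdeal_singleton_iff, aeval_eq_eval]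
    have hI : ∀ F ∈ jacobianIdeal f ⊔ Ideal.span {ℓ - 1}, eval w F = 0 := fun F hF => by
      rw [← hmem, Ideal.Quotient.eq_zero_iff_mem.2 hF]; exact zero_mem _
    have hwℓ : eval w ℓ = 1 := by
      have := hI _ (Ideal.mem_sup_right (Ideal.subset_span rfl))
      rwa [map_sub, map_one, sub_eq_zero] at this
    have hw0 : w ≠ 0 := by
      rintro rfl
      have := eval_smul_of_isHomogeneous hℓ 0 0
      rw [smul_zero, hwℓ] at this
      simp at this
    obtain ⟨p, hp, t, ht, htw⟩ := exists_plane_zero (a := fun i => pderiv i f)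
      (fun i => hf.isHomogeneous.pderiv) hw0
      fun i => hI _ (Ideal.mem_sup_left (Ideal.subset_span ⟨i, rfl⟩))
    refine ⟨⟨p, hp⟩, PrimeSpectrum.ext (Ideal.ext fun r => ?_)⟩
    obtain ⟨F, rfl⟩ := Ideal.Quotient.mk_surjective r
    rw [hmem, RingHom.mem_ker, sectionEval_mk]
    have : (eval p.rep ℓ)⁻¹ • p.rep = w := by
      rw [htw, eval_smul_of_isHomogeneous hℓ, hwℓ, pow_one, mul_one, smul_smul,
        inv_mul_cancel₀ ht, one_smul]
    rw [this]
  · intro p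
    have hprime : (RingHom.ker (sectionEval _ (hn p))).IsPrime := RingHom.ker_isPrime _
    refine affineTjurina_eq_finrank hf hd hℓ (rep_chartIndex_ne_zero p.1) (hc _ p.2)
      (RingHom.ker (sectionEval _ (hn p))) (ε := sectionEval _ (hn p)) (fun j => ?_) fun r => Iff.rfl
    rw [sectionEval_mk]
    simp [div_eq_inv_mul]

/-- The Hilbert polynomial of the Jacobian algebra is the total Tjurina number. -/
theorem IsReducedCurve.exists_finrank_jacobianIdeal {d : ℕ} {f : S} (hf : IsReducedCurve d f)
    (hd : 0 < d) : ∃ K, ∀ k ≥ K,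
      Module.finrank ℂ (gradedPiece (jacobianIdeal f) k) + totalTjurina f = (k + 2).choose 2 := by
  have hhom : ∀ i, (pderiv i f).IsHomogeneous (d - 1) := fun i => hf.isHomogeneous.pderiv
  obtain ⟨c, -, hc⟩ := exists_linearForm _
    (finite_zeros hhom (hf.isPrimitiveVector_gradient hd))
  obtain ⟨N, hN⟩ := exists_forms_le hhom hc
  obtain ⟨hfin, K, hK⟩ := finrank_affineSection (I := jacobianIdeal f) (isGradedIdeal_span hhom)
    (isHomogeneous_linearForm c) hN
  refine ⟨K, fun k hk => ?_⟩
  rw [totalTjurina_eq_finrank hf hd (isHomogeneous_linearForm c) hc]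
  exact hK k hk

/-! ### The cofactor ideal of a syzygy of minimal degree -/

/-- The ideal of the `h` such that `a × b = h ∇f` for some Jacobian syzygy `b`. -/
noncomputable def cofactorIdeal (f : S) (a : Fin 3 → S) : Ideal S :=
  ((syzygies f).map (crossProduct a)).comap
    (LinearMap.toSpanSingleton S (Fin 3 → S) fun i => pderiv i f)

/-- The relation `a × b = h ∇f`, written in components. -/
def IsCofactor (f : S) (a b : Fin 3 → S) (h : S) : Prop :=
  crossProduct a b = h • fun i => pderiv i f

theorem isCofactor_iff {f : S} {a b : Fin 3 → S} {h : S} : IsCofactor f a b h ↔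
    a 1 * b 2 - a 2 * b 1 = h * pderiv 0 f ∧ a 2 * b 0 - a 0 * b 2 = h * pderiv 1 f ∧
      a 0 * b 1 - a 1 * b 0 = h * pderiv 2 f := by
  rw [IsCofactor, cross_apply, funext_iff, Fin.forall_fin_succ, Fin.forall_fin_succ,
    Fin.forall_fin_succ]
  simp

theorem mem_cofactorIdeal {f : S} {a : Fin 3 → S} {h : S} :
    h ∈ cofactorIdeal f a ↔ ∃ b ∈ syzygies f, IsCofactor f a b h := by
  simp [cofactorIdeal, IsCofactor]

theorem mem_syzygies_iff {f : S} {a : Fin 3 → S} : a ∈ syzygies f ↔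
    a 0 * pderiv 0 f + a 1 * pderiv 1 f + a 2 * pderiv 2 f = 0 := by
  rw [mem_syzygies, Fin.sum_univ_three]

/-- The vectors `a` and `b` are orthogonal to the gradient, so `a × b` is parallel to it; the
gradient is primitive, so the factor is a polynomial. -/
theorem exists_isCofactor {d : ℕ} {f : S} (hf : IsReducedCurve d f) (hd : 0 < d) {a b : Fin 3 → S}
    (ha : a ∈ syzygies f) (hb : b ∈ syzygies f) : ∃ h, IsCofactor f a b h := by
  have hp := hf.isPrimitiveVector_gradient hd
  obtain ⟨i₀, hi₀⟩ := hp.exists_ne_zero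
  rw [mem_syzygies_iff] at ha hb
  obtain ⟨h, hh⟩ := hp.exists_eq_mul (v := crossProduct a b) hi₀ (by
    rw [cross_apply]
    intro i j
    fin_cases i <;> fin_cases j <;> simp
    · linear_combination b 2 * ha - a 2 * hb
    · linear_combination -b 1 * ha + a 1 * hb
    · linear_combination -b 2 * ha + a 2 * hb
    · linear_combination b 0 * ha - a 0 * hb
    · linear_combination b 1 * ha - a 1 * hb
    · linear_combination -b 0 * ha + a 0 * hb)
  exact ⟨h, funext hh⟩

theorem cross_eq_zero_iff {R : Type*} [CommRing R] {a b : Fin 3 → R} :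
    (a 1 * b 2 - a 2 * b 1 = 0 ∧ a 2 * b 0 - a 0 * b 2 = 0 ∧ a 0 * b 1 - a 1 * b 0 = 0) ↔
      ∀ i j, b i * a j = b j * a i := by
  constructor
  · rintro ⟨h0, h1, h2⟩ i j
    fin_cases i <;> fin_cases j <;> simp
    · linear_combination -h2
    · linear_combination h1
    · linear_combination h2
    · linear_combination -h0
    · linear_combination -h1
    · linear_combination h0
  · intro h
    exact ⟨by linear_combination h 2 1, by linear_combination h 0 2, by linear_combination h 1 0⟩

theorem IsMinimalSyzygy.exists_eq_smul {d r : ℕ} {f : S} (hf : f.IsHomogeneous d) {a b : Fin 3 → S}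
    (ha : IsMinimalSyzygy f r a) (h : IsCofactor f a b 0) : ∃ s : S, b = s • a := by
  have hp := ha.isPrimitiveVector hf
  obtain ⟨i₀, hi₀⟩ := hp.exists_ne_zero
  rw [isCofactor_iff] at h
  simp only [zero_mul] at h
  obtain ⟨s, hs⟩ := hp.exists_eq_mul hi₀ (cross_eq_zero_iff.1 h)
  exact ⟨s, funext hs⟩

theorem isCofactor_smul_self (f : S) (a : Fin 3 → S) (s : S) : IsCofactor f a (s • a) 0 := by
  simp [IsCofactor]

theorem IsCofactor.congr_add {f : S} {a b b' : Fin 3 → S} {h h' : S} (hb : IsCofactor f a b h)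
    (hb' : IsCofactor f a b' h') : IsCofactor f a (b + b') (h + h') := by
  rw [IsCofactor] at *
  rw [map_add, hb, hb', add_smul]

theorem IsCofactor.smul {f : S} {a b : Fin 3 → S} {h : S} (s : S) (hb : IsCofactor f a b h) :
    IsCofactor f a (s • b) (s * h) := by
  rw [IsCofactor] at *
  rw [map_smul, hb, smul_smul]

theorem IsCofactor.unique {d : ℕ} {f : S} (hf : IsReducedCurve d f) (hd : 0 < d) {a b : Fin 3 → S}
    {h h' : S} (hb : IsCofactor f a b h) (hb' : IsCofactor f a b h') : h = h' := by
  obtain ⟨i, hi⟩ := (hf.isPrimitiveVector_gradient hd).exists_ne_zero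
  rw [IsCofactor] at hb hb'
  exact mul_right_cancel₀ hi (congrFun (hb.symm.trans hb') i)

/-- Both sides of `a × b = h ∇f` are compared in degree `r + k = d - 1 + j`; this is the degree
shift between syzygies and cofactors. -/
theorem IsCofactor.homogeneousComponent {d r j k : ℕ} {f : S} (hf : IsReducedCurve d f)
    {a b : Fin 3 → S} {h : S} (hab : IsCofactor f a b h) (ha : ∀ i, (a i).IsHomogeneous r)
    (hj : r + k = d - 1 + j) :
    IsCofactor f a (fun i => MvPolynomial.homogeneousComponent k (b i))
      (MvPolynomial.homogeneousComponent j h) := by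
  rw [isCofactor_iff] at hab ⊢
  have key : ∀ (p q s t : Fin 3) (e : Fin 3),
      a p * b q - a s * b t = h * pderiv e f →
      a p * MvPolynomial.homogeneousComponent k (b q) -
        a s * MvPolynomial.homogeneousComponent k (b t) =
          MvPolynomial.homogeneousComponent j h * pderiv e f := by
    intro p q s t e heq
    have := congrArg (MvPolynomial.homogeneousComponent (r + k)) heq
    rwa [map_sub, homogeneousComponent_homogeneous_mul (ha p),
      homogeneousComponent_homogeneous_mul (ha s), hj, mul_comm h,
      homogeneousComponent_homogeneous_mul hf.isHomogeneous.pderiv, mul_comm (pderiv e f)] at this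
  exact ⟨key _ _ _ _ _ hab.1, key _ _ _ _ _ hab.2.1, key _ _ _ _ _ hab.2.2⟩

theorem IsCofactor.isHomogeneous {d r j k : ℕ} {f : S} (hf : IsReducedCurve d f) (hd : 0 < d)
    {a b : Fin 3 → S} {h : S} (hab : IsCofactor f a b h) (ha : ∀ i, (a i).IsHomogeneous r)
    (hb : ∀ i, (b i).IsHomogeneous k) (hj : r + k = d - 1 + j) : h.IsHomogeneous j := by
  have h1 := hab.homogeneousComponent hf ha hj
  have h2 : (fun i => MvPolynomial.homogeneousComponent k (b i)) = b :=
    funext fun i => homogeneousComponent_eq_self (hb i)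
  rw [h2] at h1
  rw [hab.unique hf hd h1]
  exact homogeneousComponent_isHomogeneous _ _

/-- The Koszul syzygies `(f_y, -f_x, 0)` and `(f_z, 0, -f_x)` have degree `d - 1`; they cannot both
vanish, as the gradient is nonzero. -/
theorem IsMinimalSyzygy.le {d r : ℕ} {f : S} (hf : IsReducedCurve d f) (hd : 0 < d)
    {a : Fin 3 → S} (ha : IsMinimalSyzygy f r a) : r ≤ d - 1 := by
  have hhom : ∀ i, (pderiv i f).IsHomogeneous (d - 1) := fun i => hf.isHomogeneous.pderiv
  by_contra! hlt
  have h1 : ![pderiv 1 f, -pderiv 0 f, 0] = 0 := by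
    by_contra h
    refine hlt.not_ge (ha.minimal _ ?_ (d - 1) (fun i => ?_) h)
    · rw [mem_syzygies_iff]; simp; ring
    · fin_cases i
      exacts [hhom 1, (hhom 0).neg, isHomogeneous_zero _ _ _]
  have h2 : ![pderiv 2 f, 0, -pderiv 0 f] = 0 := by
    by_contra h
    refine hlt.not_ge (ha.minimal _ ?_ (d - 1) (fun i => ?_) h)
    · rw [mem_syzygies_iff]; simp; ring
    · fin_cases i
      exacts [hhom 2, isHomogeneous_zero _ _ _, (hhom 0).neg]
  obtain ⟨i, hi⟩ := (hf.isPrimitiveVector_gradient hd).exists_ne_zero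
  apply hi
  fin_cases i
  · simpa using congrFun h1 1
  · exact congrFun h1 0
  · exact congrFun h2 0

theorem isGradedIdeal_cofactorIdeal {d r : ℕ} {f : S} (hf : IsReducedCurve d f) (hd : 0 < d)
    {a : Fin 3 → S} (ha : IsMinimalSyzygy f r a) : IsGradedIdeal (cofactorIdeal f a) := by
  intro h hh j
  obtain ⟨b, hb, hab⟩ := mem_cofactorIdeal.1 hh
  have hr := ha.le hf hd
  exact mem_cofactorIdeal.2 ⟨_, homogeneousComponent_mem_syzygies hf.isHomogeneous hb _,
    hab.homogeneousComponent hf ha.homogeneous (k := d - 1 - r + j) (by omega)⟩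

/-! ### Dimension count -/

/-- The Jacobian syzygies of degree `k`. -/
noncomputable def syzygyForms (f : S) (k : ℕ) : Submodule ℂ (Fin 3 → S) :=
  (syzygies f).restrictScalars ℂ ⊓ vectorForms k

theorem mem_syzygyForms {f : S} {k : ℕ} {b : Fin 3 → S} :
    b ∈ syzygyForms f k ↔ b ∈ syzygies f ∧ ∀ i, (b i).IsHomogeneous k := by
  rw [syzygyForms, Submodule.mem_inf, mem_vectorForms, Submodule.restrictScalars_mem]

theorem range_compLeft_forms (k : ℕ) :
    LinearMap.range ((forms k).subtype.compLeft (Fin 3)) = vectorForms k := by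
  ext v
  rw [mem_vectorForms, LinearMap.mem_range]
  constructor
  · rintro ⟨w, rfl⟩ i
    exact (w i).2
  · exact fun h => ⟨fun i => ⟨v i, h i⟩, rfl⟩

instance (k : ℕ) : FiniteDimensional ℂ (vectorForms k) := by
  rw [← range_compLeft_forms]; infer_instance

instance (f : S) (k : ℕ) : FiniteDimensional ℂ (syzygyForms f k) :=
  Submodule.finiteDimensional_of_le (inf_le_right : syzygyForms f k ≤ vectorForms k)

theorem finrank_vectorForms (k : ℕ) :
    Module.finrank ℂ (vectorForms k) = 3 * (k + 2).choose 2 := by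
  have hinj : Function.Injective ((forms k).subtype.compLeft (Fin 3)) := fun v w h =>
    funext fun i => Subtype.ext (congrFun h i)
  rw [← range_compLeft_forms, LinearMap.finrank_range_of_inj hinj, Module.finrank_pi_fintype]
  simp [finrank_forms]

/-- Rank-nullity for `b ↦ ∑ b_i f_i` on triples of forms of degree `k`. -/
theorem finrank_syzygyForms_add {d : ℕ} {f : S} (hf : IsReducedCurve d f) (k : ℕ) :
    Module.finrank ℂ (syzygyForms f k) +
      Module.finrank ℂ (gradedPiece (jacobianIdeal f) (k + (d - 1))) = 3 * (k + 2).choose 2 := by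
  let θ : (Fin 3 → S) →ₗ[ℂ] S :=
    (∑ i, (LinearMap.mulRight S (pderiv i f)).comp (LinearMap.proj i)).restrictScalars ℂ
  have hθ : ∀ b, θ b = ∑ i, b i * pderiv i f := fun b => by
    simp [θ]
  have h1 := finrank_map_add_finrank_inf_ker θ (vectorForms k)
  have h2 : vectorForms k ⊓ LinearMap.ker θ = syzygyForms f k := by
    ext b
    rw [Submodule.mem_inf, LinearMap.mem_ker, hθ, mem_syzygyForms, mem_vectorForms, and_comm]
    rfl
  have h3 : (vectorForms k).map θ = gradedPiece (jacobianIdeal f) (k + (d - 1)) := by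
    ext F
    rw [mem_gradedPiece]
    constructor
    · rintro ⟨b, hb, rfl⟩
      rw [hθ]
      refine ⟨Ideal.sum_mem _ fun i _ => Ideal.mul_mem_left _ _ (Ideal.subset_span ⟨i, rfl⟩),
        IsHomogeneous.sum _ _ _ fun i _ => (mem_vectorForms.1 hb i).mul hf.isHomogeneous.pderiv⟩
    · rintro ⟨hF, hFh⟩
      obtain ⟨b, hb, hbF⟩ := exists_homogeneous_coeff (n := fun _ => d - 1)
        (fun i => hf.isHomogeneous.pderiv) hFh (fun _ => by omega) hF
      refine ⟨b, mem_vectorForms.2 fun i => ?_, by rw [hθ, hbF]⟩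
      simpa using hb i
  rw [h2, h3, finrank_vectorForms] at h1
  rw [add_comm, h1]

/-- Rank-nullity for `b ↦ a × b`. In degree `j + d - 1`, the kernel is `a` times the forms of degree
`j + s`, and the image is `∇f` times the part of degree `j + r` of the cofactor ideal. -/
theorem finrank_syzygyForms {d r s : ℕ} {f : S} (hf : IsReducedCurve d f) (hd : 0 < d)
    {a : Fin 3 → S} (ha : IsMinimalSyzygy f r a) (hs : r + s = d - 1) (j : ℕ) :
    Module.finrank ℂ (syzygyForms f (j + (r + s))) =
      Module.finrank ℂ (gradedPiece (cofactorIdeal f a) (j + r)) + (j + s + 2).choose 2 := by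
  let χ : (Fin 3 → S) →ₗ[ℂ] (Fin 3 → S) := (crossProduct a).restrictScalars ℂ
  let γ : S →ₗ[ℂ] (Fin 3 → S) :=
    (LinearMap.toSpanSingleton S (Fin 3 → S) fun i => pderiv i f).restrictScalars ℂ
  let α : S →ₗ[ℂ] (Fin 3 → S) := (LinearMap.toSpanSingleton S (Fin 3 → S) a).restrictScalars ℂ
  have hχ : ∀ b h, χ b = γ h ↔ IsCofactor f a b h := fun b h => Iff.rfl
  have hγ : Function.Injective γ := by
    obtain ⟨i, hi⟩ := (hf.isPrimitiveVector_gradient hd).exists_ne_zero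
    exact fun F G h => mul_right_cancel₀ hi (congrFun h i)
  have hα : Function.Injective α := by
    obtain ⟨i, hi⟩ := (ha.isPrimitiveVector hf.isHomogeneous).exists_ne_zero
    exact fun F G h => mul_right_cancel₀ hi (congrFun h i)
  have h1 := finrank_map_add_finrank_inf_ker χ (syzygyForms f (j + (r + s)))
  have h2 : syzygyForms f (j + (r + s)) ⊓ LinearMap.ker χ = (forms (j + s)).map α := by
    ext b
    rw [Submodule.mem_inf, mem_syzygyForms, LinearMap.mem_ker, Submodule.mem_map]
    constructor
    · rintro ⟨⟨-, hbh⟩, hb0⟩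
      have hb0' : IsCofactor f a b 0 := by rw [← hχ, hb0, map_zero]
      obtain ⟨t, rfl⟩ := ha.exists_eq_smul hf.isHomogeneous hb0'
      refine ⟨homogeneousComponent (j + s) t, homogeneousComponent_isHomogeneous _ _, ?_⟩
      funext i
      have := homogeneousComponent_eq_self (hbh i)
      rw [Pi.smul_apply, smul_eq_mul, mul_comm, show j + (r + s) = r + (j + s) by ring,
        homogeneousComponent_homogeneous_mul (ha.homogeneous i), mul_comm] at this
      rw [mul_comm] at this
      exact (mul_comm _ _).trans (this.trans (mul_comm _ _))
    · rintro ⟨t, ht, rfl⟩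
      refine ⟨⟨(syzygies f).smul_mem t ha.mem, fun i => ?_⟩, ?_⟩
      · have := (show t.IsHomogeneous (j + s) from ht).mul (ha.homogeneous i)
        rwa [show j + s + r = j + (r + s) by ring] at this
      · have := (hχ (t • a) 0).2 (isCofactor_smul_self f a t)
        rwa [map_zero] at this
  have h3 : (syzygyForms f (j + (r + s))).map χ =
      (gradedPiece (cofactorIdeal f a) (j + r)).map γ := by
    ext v
    rw [Submodule.mem_map, Submodule.mem_map]
    constructor
    · rintro ⟨b, hb, rfl⟩
      obtain ⟨hb, hbh⟩ := mem_syzygyForms.1 hb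
      obtain ⟨h, hh⟩ := exists_isCofactor hf hd ha.mem hb
      exact ⟨h, mem_gradedPiece.2 ⟨mem_cofactorIdeal.2 ⟨b, hb, hh⟩,
        hh.isHomogeneous hf hd ha.homogeneous hbh (by omega)⟩, ((hχ b h).2 hh).symm⟩
    · rintro ⟨h, hh, rfl⟩
      obtain ⟨hh, hhom⟩ := mem_gradedPiece.1 hh
      obtain ⟨b, hb, hab⟩ := mem_cofactorIdeal.1 hh
      have := hab.homogeneousComponent hf ha.homogeneous (k := j + (r + s)) (j := j + r) (by omega)
      rw [homogeneousComponent_eq_self hhom] at this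
      exact ⟨_, mem_syzygyForms.2 ⟨homogeneousComponent_mem_syzygies hf.isHomogeneous hb _,
        fun i => homogeneousComponent_isHomogeneous _ _⟩, (hχ _ _).2 this⟩
  rw [h2, h3, finrank_map_of_injective _ hγ, finrank_map_of_injective _ hα, finrank_forms] at h1
  exact h1.symm

theorem two_mul_choose_two (k : ℕ) : 2 * ((k + 2).choose 2 : ℤ) = (k + 2) * (k + 1) := by
  have h : (((k + 2).choose 2 : ℕ) : ℚ) = _ := Nat.cast_choose_two ℚ (k + 2)
  have : (2 * ((k + 2).choose 2 : ℤ) : ℚ) = (k + 2) * (k + 1) := by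
    push_cast at h ⊢
    rw [h]; ring
  exact_mod_cast this

/-- The Hilbert polynomial of `S ⧸ cofactorIdeal f a` is the defect `τ(d, r)_max - τ`. -/
theorem exists_finrank_cofactorIdeal {d r : ℕ} {f : S} (hf : IsReducedCurve d f) (hd : 0 < d)
    {a : Fin 3 → S} (ha : IsMinimalSyzygy f r a) : ∃ K, ∀ k ≥ K,
      (Module.finrank ℂ (gradedPiece (cofactorIdeal f a) k) : ℤ) + (tauMax d r - totalTjurina f) =
        (k + 2).choose 2 := by
  obtain ⟨K, hK⟩ := hf.exists_finrank_jacobianIdeal hd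
  obtain ⟨s, hs⟩ := Nat.exists_eq_add_of_le (ha.le hf hd)
  refine ⟨K + r, fun k hk => ?_⟩
  obtain ⟨j, rfl⟩ := Nat.exists_eq_add_of_le' (show r ≤ k by omega)
  -- The degrees are matched so that the dimensions of the Jacobian ideal and of the syzygies can be
  -- eliminated; the terms in `j` then cancel and leave a constant.
  have e1 := hK (j + (r + s) + (d - 1)) (by omega)
  have e2 := finrank_syzygyForms_add hf (j + (r + s))
  have e3 := finrank_syzygyForms hf hd ha hs.symm j
  have hd1 : (d : ℤ) = r + s + 1 := by omega
  rw [hs] at e1 e2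
  zify at e1 e2 e3
  have c1 := two_mul_choose_two (j + (r + s) + (r + s))
  have c2 := two_mul_choose_two (j + (r + s))
  have c3 := two_mul_choose_two (j + s)
  have c4 := two_mul_choose_two (j + r)
  push_cast at e1 e2 e3 c1 c2 c3 c4 ⊢
  have h5 : 2 * tauMax d r = 2 * (r + s : ℤ) ^ 2 - 2 * r * s := by
    rw [tauMax, hd1]; ring
  have : (2 : ℤ) ≠ 0 := two_ne_zero
  apply mul_left_cancel₀ this
  linear_combination -2 * e1 + 2 * e2 - 2 * e3 + h5 - c4 - c3 + 3 * c2 - c1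

/-! ### A linear form that is regular modulo the cofactor ideal -/

/-- The parametrization of the plane `x + c₁ y + c₂ z = 0` by `y` and `z`. -/
noncomputable def lineRestriction (c : Fin 3 → ℂ) : S →ₐ[ℂ] MvPolynomial (Fin 2) ℂ :=
  aeval ![-(C (c 1) * X 0 + C (c 2) * X 1), X 0, X 1]

theorem lineRestriction_linearForm {c : Fin 3 → ℂ} (hc : c 0 = 1) :
    lineRestriction c (linearForm c) = 0 := by
  simp only [lineRestriction, linearForm, Fin.sum_univ_three, hc]
  simp

/-- The section of `lineRestriction` with values in the polynomials in the last two variables. -/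
noncomputable def lineLift : MvPolynomial (Fin 2) ℂ →ₐ[ℂ] S := aeval ![X 1, X 2]

theorem lineRestriction_lineLift (c : Fin 3 → ℂ) (p : MvPolynomial (Fin 2) ℂ) :
    lineRestriction c (lineLift p) = p := by
  have : (lineRestriction c).comp lineLift = AlgHom.id ℂ _ := by
    ext i
    fin_cases i <;> simp [lineRestriction, lineLift]
  exact DFunLike.congr_fun this p

theorem linearForm_dvd_sub_lineLift {c : Fin 3 → ℂ} (hc : c 0 = 1) (F : S) :
    linearForm c ∣ F - lineLift (lineRestriction c F) := by
  have : (Ideal.Quotient.mkₐ ℂ (Ideal.span {linearForm c})).comp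
      (lineLift.comp (lineRestriction c)) = Ideal.Quotient.mkₐ ℂ (Ideal.span {linearForm c}) := by
    refine MvPolynomial.algHom_ext fun i => ?_
    refine Ideal.Quotient.eq.2 (Ideal.mem_span_singleton.2 ?_)
    fin_cases i
    · refine ⟨-1, ?_⟩
      simp [lineRestriction, lineLift, linearForm, Fin.sum_univ_three, hc]
      ring
    · simp [lineRestriction, lineLift]
    · simp [lineRestriction, lineLift]
  rw [← Ideal.mem_span_singleton]
  exact Ideal.Quotient.eq.1 (DFunLike.congr_fun this F).symm

/-- The ideal `(a, ℓ)` contains powers of `y` and `z`, so a common prime of the restrictions would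
divide both coordinates of the plane `ℓ = 0`. -/
theorem isPrimitiveVector_lineRestriction {a : Fin 3 → S} {c : Fin 3 → ℂ} (hc : c 0 = 1) {N : ℕ}
    (hN : ∀ k ≥ N, ∀ F : S, F.IsHomogeneous k →
      F ∈ Ideal.span (Set.range a) ⊔ Ideal.span {linearForm c}) :
    IsPrimitiveVector fun i => lineRestriction c (a i) := by
  intro p hp
  by_contra! hdvd
  have hle : Ideal.span (Set.range a) ⊔ Ideal.span {linearForm c} ≤
      (Ideal.span {p}).comap (lineRestriction c) := by
    refine sup_le (Ideal.span_le.2 ?_) (Ideal.span_le.2 ?_)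
    · rintro _ ⟨i, rfl⟩
      exact Ideal.mem_span_singleton.2 (hdvd i)
    · rintro _ rfl
      change lineRestriction c (linearForm c) ∈ Ideal.span {p}
      rw [lineRestriction_linearForm hc]; exact zero_mem _
  have h0 : p ∣ X 0 := by
    have := hle (hN N le_rfl (X 1 ^ N) (isHomogeneous_X_pow 1 N))
    rw [Ideal.mem_comap, Ideal.mem_span_singleton, map_pow] at this
    simpa [lineRestriction] using hp.dvd_of_dvd_pow this
  have h1 : p ∣ X 1 := by
    have := hle (hN N le_rfl (X 2 ^ N) (isHomogeneous_X_pow 2 N))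
    rw [Ideal.mem_comap, Ideal.mem_span_singleton, map_pow] at this
    simpa [lineRestriction] using hp.dvd_of_dvd_pow this
  have hX : Prime (X 0 : MvPolynomial (Fin 2) ℂ) := prime_of_totalDegree_eq_one (totalDegree_X 0)
  obtain ⟨w, hw⟩ := ((hp.associated_of_dvd hX h0).symm.dvd).trans h1
  have := congrArg (eval ![0, 1]) hw
  simp at this

/-- If `a × b = ℓ h ∇f`, then `a` and `b` become parallel on `ℓ = 0`, where `a` stays primitive.
Hence `b = s a + ℓ b'` for a lifted `s`, and cancelling `ℓ` gives `a × b' = h ∇f` with `b'` a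
syzygy. -/
theorem mem_cofactorIdeal_of_linearForm_mul_mem {r : ℕ} {f : S}
    {a : Fin 3 → S} (ha : IsMinimalSyzygy f r a) {c : Fin 3 → ℂ} (hc : c 0 = 1)
    {N : ℕ} (hN : ∀ k ≥ N, ∀ F : S, F.IsHomogeneous k →
      F ∈ Ideal.span (Set.range a) ⊔ Ideal.span {linearForm c}) {h : S}
    (hh : linearForm c * h ∈ cofactorIdeal f a) : h ∈ cofactorIdeal f a := by
  obtain ⟨b, hb, hab⟩ := mem_cofactorIdeal.1 hh
  have hprim := isPrimitiveVector_lineRestriction hc hN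
  obtain ⟨i₀, hi₀⟩ := hprim.exists_ne_zero
  have hab' := isCofactor_iff.1 hab
  obtain ⟨s, hs⟩ := hprim.exists_eq_mul (v := fun i => lineRestriction c (b i)) hi₀ (by
    refine cross_eq_zero_iff.1 ⟨?_, ?_, ?_⟩
    · have := congrArg (lineRestriction c) hab'.1
      simpa [lineRestriction_linearForm hc] using this
    · have := congrArg (lineRestriction c) hab'.2.1
      simpa [lineRestriction_linearForm hc] using this
    · have := congrArg (lineRestriction c) hab'.2.2
      simpa [lineRestriction_linearForm hc] using this)
  have hdvd : ∀ i, linearForm c ∣ b i - lineLift s * a i := by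
    intro i
    have h1 := linearForm_dvd_sub_lineLift hc (b i - lineLift s * a i)
    rwa [map_sub, map_mul, lineRestriction_lineLift, hs, sub_self, map_zero, sub_zero] at h1
  choose b' hb' using hdvd
  have hbb : b = lineLift s • a + linearForm c • b' := by
    funext i
    rw [Pi.add_apply, Pi.smul_apply, Pi.smul_apply, smul_eq_mul, smul_eq_mul, ← hb']
    ring
  have hℓ : linearForm c ≠ 0 := by
    intro h0
    have := congrArg (eval ![1, 0, 0]) h0
    rw [eval_linearForm, map_zero, Fin.sum_univ_three] at this
    simp [hc] at this
  have hb's : b' ∈ syzygies f := by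
    have h1 : linearForm c • b' ∈ syzygies f := by
      have : linearForm c • b' = b - lineLift s • a := by rw [hbb, add_sub_cancel_left]
      rw [this]
      exact sub_mem hb ((syzygies f).smul_mem _ ha.mem)
    rw [mem_syzygies] at h1 ⊢
    have h2 : ∑ i, (linearForm c • b') i * pderiv i f =
        linearForm c * ∑ i, b' i * pderiv i f := by
      rw [Finset.mul_sum]
      exact Finset.sum_congr rfl fun i _ => mul_assoc _ _ _
    rw [h2] at h1
    exact (mul_eq_zero.1 h1).resolve_left hℓ
  refine mem_cofactorIdeal.2 ⟨b', hb's, ?_⟩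
  have h2 : linearForm c • crossProduct a b' =
      linearForm c • (h • fun i => pderiv i f : Fin 3 → S) := by
    have h3 := isCofactor_smul_self f a (lineLift s)
    rw [IsCofactor] at hab h3
    rw [hbb, map_add, h3, zero_smul, zero_add, map_smul] at hab
    rw [hab, smul_smul]
  funext i
  exact mul_left_cancel₀ hℓ (congrFun h2 i)

/-- There is a linear form that is a nonzerodivisor modulo the cofactor ideal. -/
theorem exists_linearForm_regular {d r : ℕ} {f : S} (hf : IsReducedCurve d f)
    {a : Fin 3 → S} (ha : IsMinimalSyzygy f r a) : ∃ ℓ : S, ℓ.IsHomogeneous 1 ∧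
      ∀ h, ℓ * h ∈ cofactorIdeal f a → h ∈ cofactorIdeal f a := by
  obtain ⟨c, hc, hcz⟩ := exists_linearForm _
    (finite_zeros ha.homogeneous (ha.isPrimitiveVector hf.isHomogeneous))
  obtain ⟨N, hN⟩ := exists_forms_le ha.homogeneous hcz
  exact ⟨_, isHomogeneous_linearForm c, fun h =>
    mem_cofactorIdeal_of_linearForm_mul_mem ha hc hN⟩

/-! ### Graded ideals of zero-dimensional schemes of small degree -/

section SmallDegree

variable {I : Ideal S} {ℓ : S}

theorem exists_sum_X_mul {k : ℕ} {F : S} (hF : F.IsHomogeneous (k + 1)) :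
    ∃ G : Fin 3 → S, (∀ i, (G i).IsHomogeneous k) ∧ ∑ i, G i * X i = F := by
  refine exists_homogeneous_coeff (a := fun i => (X i : S)) (n := fun _ => 1)
    (fun i => isHomogeneous_X ℂ i) hF (fun _ => by omega) ?_
  have h1 : F ∈ Ideal.span (Set.range (X : Fin 3 → S)) ^ (k + 1) := by
    rw [Ideal.mem_span_pow_iff_exists_isHomogeneous]
    exact ⟨map C F, hF.map C, by rw [eval_map]; exact eval₂_eta F⟩
  exact Ideal.pow_le_self (Nat.succ_ne_zero k) h1

theorem forms_mem_of_le {k₀ : ℕ} (h : ∀ F : S, F.IsHomogeneous k₀ → F ∈ I) {k : ℕ} (hk : k₀ ≤ k) :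
    ∀ F : S, F.IsHomogeneous k → F ∈ I := by
  induction k, hk using Nat.le_induction with
  | base => exact h
  | succ k _ ih =>
    intro F hF
    obtain ⟨G, hG, rfl⟩ := exists_sum_X_mul hF
    exact I.sum_mem fun i _ => I.mul_mem_right _ (ih _ (hG i))

/-- The image of the forms of degree `k` in the quotient by `I`. -/
noncomputable def quotientPiece (I : Ideal S) (k : ℕ) : Submodule ℂ (S ⧸ I) :=
  (forms k).map (Ideal.Quotient.mkₐ ℂ I).toLinearMap

instance (k : ℕ) : FiniteDimensional ℂ (quotientPiece I k) :=
  inferInstanceAs (FiniteDimensional ℂ ((forms k).map (Ideal.Quotient.mkₐ ℂ I).toLinearMap))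

theorem finrank_quotientPiece_add (I : Ideal S) (k : ℕ) :
    Module.finrank ℂ (quotientPiece I k) + Module.finrank ℂ (gradedPiece I k) =
      (k + 2).choose 2 := by
  have h1 := finrank_map_add_finrank_inf_ker (Ideal.Quotient.mkₐ ℂ I).toLinearMap (forms k)
  have h2 : forms k ⊓ LinearMap.ker (Ideal.Quotient.mkₐ ℂ I).toLinearMap = gradedPiece I k := by
    ext F
    rw [Submodule.mem_inf, mem_gradedPiece, and_comm]
    exact and_congr_left fun _ => Ideal.Quotient.eq_zero_iff_mem
  rw [h2, finrank_forms] at h1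
  exact h1

theorem injective_mulLeft_mk (hreg : ∀ h, ℓ * h ∈ I → h ∈ I) :
    Function.Injective (LinearMap.mulLeft ℂ (Ideal.Quotient.mk I ℓ)) := by
  rw [injective_iff_map_eq_zero]
  intro x hx
  obtain ⟨F, rfl⟩ := Ideal.Quotient.mk_surjective x
  rw [LinearMap.mulLeft_apply, ← map_mul, Ideal.Quotient.eq_zero_iff_mem] at hx
  exact Ideal.Quotient.eq_zero_iff_mem.2 (hreg F hx)

theorem map_mulLeft_quotientPiece_le (hℓ : ℓ.IsHomogeneous 1) (k : ℕ) :
    (quotientPiece I k).map (LinearMap.mulLeft ℂ (Ideal.Quotient.mk I ℓ)) ≤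
      quotientPiece I (k + 1) := by
  rintro _ ⟨_, ⟨F, hF, rfl⟩, rfl⟩
  refine ⟨ℓ * F, ?_, map_mul (Ideal.Quotient.mk I) _ _⟩
  have := hℓ.mul (show F.IsHomogeneous k from hF)
  rwa [add_comm] at this

theorem finrank_quotientPiece_le_succ (hℓ : ℓ.IsHomogeneous 1) (hreg : ∀ h, ℓ * h ∈ I → h ∈ I)
    (k : ℕ) : Module.finrank ℂ (quotientPiece I k) ≤ Module.finrank ℂ (quotientPiece I (k + 1)) := by
  rw [← finrank_map_of_injective _ (injective_mulLeft_mk hreg) (quotientPiece I k)]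
  exact Submodule.finrank_mono (map_mulLeft_quotientPiece_le hℓ k)

/-- The Hilbert function of `S ⧸ I` is stationary at `k` if and only if the forms of degree `k + 1`
lie in `I + (ℓ)`. -/
theorem finrank_quotientPiece_eq_succ_iff (hI : IsGradedIdeal I) (hℓ : ℓ.IsHomogeneous 1)
    (hreg : ∀ h, ℓ * h ∈ I → h ∈ I) (k : ℕ) :
    Module.finrank ℂ (quotientPiece I k) = Module.finrank ℂ (quotientPiece I (k + 1)) ↔
      ∀ F : S, F.IsHomogeneous (k + 1) → F ∈ I ⊔ Ideal.span {ℓ} := by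
  rw [← finrank_map_of_injective _ (injective_mulLeft_mk hreg) (quotientPiece I k)]
  constructor
  · intro h F hF
    have heq := Submodule.eq_of_le_of_finrank_eq (map_mulLeft_quotientPiece_le hℓ k) h
    have hm : Ideal.Quotient.mk I F ∈ quotientPiece I (k + 1) := ⟨F, hF, rfl⟩
    rw [← heq] at hm
    obtain ⟨_, ⟨G, hG, rfl⟩, hGF⟩ := hm
    have h1 : F - ℓ * G ∈ I := Ideal.Quotient.eq.1 (hGF.symm.trans (map_mul (Ideal.Quotient.mk I) _ _).symm)
    rw [← sub_add_cancel F (ℓ * G)]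
    exact add_mem (Ideal.mem_sup_left h1)
      (Ideal.mem_sup_right (Ideal.mem_span_singleton.2 (Dvd.intro _ rfl)))
  · intro h
    rw [le_antisymm (map_mulLeft_quotientPiece_le hℓ k) ?_]
    rintro _ ⟨F, hF, rfl⟩
    obtain ⟨G, hG, hFG⟩ := exists_sub_mul_mem hI hℓ hF (h F hF)
    exact ⟨_, ⟨G, hG, rfl⟩, ((Ideal.Quotient.eq.2 hFG).trans (map_mul (Ideal.Quotient.mk I) _ _)).symm⟩

/-- The Hilbert function is nondecreasing since `ℓ` is regular. One repetition puts the forms of the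
next degree, hence of all later degrees, in `I + (ℓ)`, so the function has already reached its limit
`n`. It therefore increases strictly from `1` up to `n`, reached by degree `n - 1`. -/
theorem finrank_quotientPiece_eq {n : ℕ} (hn : 0 < n) (hI : IsGradedIdeal I)
    (hℓ : ℓ.IsHomogeneous 1) (hreg : ∀ h, ℓ * h ∈ I → h ∈ I)
    (hlim : ∃ K, ∀ k ≥ K, Module.finrank ℂ (quotientPiece I k) = n) :
    Module.finrank ℂ (quotientPiece I 0) = 1 ∧
    ∀ k, n ≤ k + 1 → Module.finrank ℂ (quotientPiece I k) = n ∧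
      ∀ F : S, F.IsHomogeneous (k + 1) → F ∈ I ⊔ Ideal.span {ℓ} := by
  set q := fun k => Module.finrank ℂ (quotientPiece I k) with hq
  obtain ⟨K, hK⟩ := hlim
  have hmono : Monotone q := monotone_nat_of_le_succ (finrank_quotientPiece_le_succ hℓ hreg)
  have hle : ∀ k, q k ≤ n := fun k =>
    (hmono (le_max_left k K)).trans (hK _ (le_max_right k K)).le
  have hsurj : ∀ k, q k = q (k + 1) → q k = n := by
    intro k hk
    have hall : ∀ t, q (k + t) = q k := by
      intro t
      induction t with
      | zero => rfl
      | succ t ih =>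
        rw [← ih, ← add_assoc]
        refine ((finrank_quotientPiece_eq_succ_iff hI hℓ hreg (k + t)).2 ?_).symm
        exact forms_mem_of_le ((finrank_quotientPiece_eq_succ_iff hI hℓ hreg k).1 hk) (by omega)
    rw [← hall K]
    exact hK _ (by omega)
  have h0 : q 0 = 1 := by
    have h1 := finrank_quotientPiece_add I 0
    -- Otherwise `I` is the whole ring and the limit is `0`, against `0 < n`.
    have h2 : q 0 ≠ 0 := by
      intro h
      have hz : Module.finrank ℂ (quotientPiece I 0) = 0 := h
      rw [Submodule.finrank_eq_zero] at hz
      have hm : Ideal.Quotient.mk I 1 ∈ quotientPiece I 0 := ⟨1, isHomogeneous_one _ _, rfl⟩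
      rw [hz, Submodule.mem_bot, Ideal.Quotient.eq_zero_iff_mem] at hm
      have hsub : Subsingleton (S ⧸ I) :=
        Ideal.Quotient.subsingleton_iff.2 ((Ideal.eq_top_iff_one I).2 hm)
      have := hK K le_rfl
      rw [Module.finrank_zero_of_subsingleton] at this
      omega
    have h3 : (0 + 2).choose 2 = 1 := rfl
    rw [h3] at h1
    change q 0 + _ = 1 at h1
    omega
  have hmin : ∀ k, min (k + 1) n ≤ q k := by
    intro k
    induction k with
    | zero => omega
    | succ k ih =>
      have h1 := hmono (Nat.le_succ k)
      have h2 := hsurj k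
      simp only [Nat.succ_eq_add_one] at h1
      omega
  have heq : ∀ k, n ≤ k + 1 → q k = n := fun k hk => by
    have := hmin k
    have := hle k
    omega
  exact ⟨h0, fun k hk => ⟨heq k hk, (finrank_quotientPiece_eq_succ_iff hI hℓ hreg k).1
    ((heq k hk).trans (heq (k + 1) (by omega)).symm)⟩⟩

theorem pow_mul_mem_regular (hreg : ∀ h, ℓ * h ∈ I → h ∈ I) (t : ℕ) {h : S}
    (hh : ℓ ^ t * h ∈ I) : h ∈ I := by
  induction t with
  | zero => simpa using hh
  | succ t ih => exact ih (hreg _ (by rwa [← mul_assoc, ← pow_succ']))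

/-- A graded ideal is generated in degrees at most `j` if the forms of degree `j + 1` are
generated by `ℓ` modulo the part of degree at most `j + 1`. -/
theorem le_of_graded_generation {I' : Ideal S} (hI : IsGradedIdeal I) (hI' : IsGradedIdeal I')
    (hle : I' ≤ I) (hℓ : ℓ.IsHomogeneous 1) (hreg : ∀ h, ℓ * h ∈ I → h ∈ I) {j : ℕ}
    (hlow : ∀ k ≤ j, ∀ F ∈ I, F.IsHomogeneous k → F ∈ I')
    (hgen : ∀ F : S, F.IsHomogeneous (j + 1) → F ∈ I' ⊔ Ideal.span {ℓ}) : I ≤ I' := by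
  have hom : ∀ k, ∀ F ∈ I, F.IsHomogeneous k → F ∈ I' := by
    intro k F hF hFk
    rcases le_or_gt k j with hk | hk
    · exact hlow k hk F hF hFk
    · obtain ⟨t, rfl⟩ := Nat.exists_eq_add_of_le hk.le
      obtain ⟨G, hG, hFG⟩ := exists_sub_pow_mul_mem hI' hℓ (N := j + 1)
        (fun k hk => forms_mem_of_le hgen hk) le_rfl t F hFk
      have h1 : G ∈ I := pow_mul_mem_regular hreg t
        ((Submodule.sub_mem_iff_right _ hF).1 (hle hFG))
      have h2 := add_mem hFG (I'.mul_mem_left (ℓ ^ t) (hlow j le_rfl G h1 hG))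
      rwa [sub_add_cancel] at h2
  exact fun F hF => mem_of_homogeneousComponent_mem fun k =>
    hom k _ (hI F hF k) (homogeneousComponent_isHomogeneous _ _)

end SmallDegree

/-! ### Explicit generators when the Hilbert polynomial is 1 or 2 -/

section SmallDegree

variable {I : Ideal S} {ℓ : S}

theorem IsHomogeneous.exists_eq_mul_of_dvd {p q : S} {m n : ℕ} (hp : p.IsHomogeneous m)
    (hq : q.IsHomogeneous (m + n)) (h : p ∣ q) : ∃ c : S, c.IsHomogeneous n ∧ q = p * c := by
  obtain ⟨c, hc⟩ := h
  refine ⟨homogeneousComponent n c, homogeneousComponent_isHomogeneous _ _, ?_⟩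
  rw [← homogeneousComponent_homogeneous_mul hp, ← hc, homogeneousComponent_eq_self hq]

theorem IsHomogeneous.eq_C {p : S} (hp : p.IsHomogeneous 0) : ∃ c : ℂ, p = C c := by
  refine ⟨coeff 0 p, ?_⟩
  rw [← homogeneousComponent_zero, homogeneousComponent_eq_self hp]

theorem IsHomogeneous.not_dvd_of_lt {p q : S} {m n : ℕ} (hp : p.IsHomogeneous m)
    (hq : q.IsHomogeneous n) (hq0 : q ≠ 0) (h : n < m) : ¬ p ∣ q := by
  rintro ⟨c, rfl⟩
  apply hq0
  rw [← homogeneousComponent_eq_self hq, homogeneousComponent_homogeneous_mul_of_lt hp _ h]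

theorem isGradedIdeal_span_pair {p q : S} {m n : ℕ} (hp : p.IsHomogeneous m)
    (hq : q.IsHomogeneous n) : IsGradedIdeal (Ideal.span {p, q}) := by
  have := isGradedIdeal_span (a := ![p, q]) (n := ![m, n]) (fun i => by fin_cases i <;> simpa)
  rwa [Matrix.range_cons_cons_empty] at this

/-- The Hilbert function of `S / I` is `1, 1, …`, so `I` contains no constant and exactly a pencil
of linear forms. Degree `1` already fills everything modulo `ℓ`, so nothing new is needed above. -/
theorem exists_two_linear_generators (hI : IsGradedIdeal I)
    (hℓ : ℓ.IsHomogeneous 1) (hreg : ∀ h, ℓ * h ∈ I → h ∈ I)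
    (hlim : ∃ K, ∀ k ≥ K, Module.finrank ℂ (quotientPiece I k) = 1) :
    ∃ p q : S, p.IsHomogeneous 1 ∧ q.IsHomogeneous 1 ∧ I = Ideal.span {p, q} ∧
      ¬ p ∣ q ∧ ¬ q ∣ p := by
  obtain ⟨h0, hn⟩ := finrank_quotientPiece_eq one_pos hI hℓ hreg hlim
  have e0 := finrank_quotientPiece_add I 0
  have e1 := finrank_quotientPiece_add I 1
  rw [h0] at e0
  rw [(hn 1 (by omega)).1] at e1
  have c0 : (0 + 2).choose 2 = 1 := rfl
  have c1 : (1 + 2).choose 2 = 3 := rfl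
  rw [c0] at e0
  rw [c1] at e1
  have f0 : gradedPiece I 0 = ⊥ := Submodule.finrank_eq_zero.1 (by omega)
  have f1 : Module.finrank ℂ (gradedPiece I 1) = 2 := by omega
  let b := Module.finBasisOfFinrankEq ℂ (gradedPiece I 1) f1
  have hb : ∀ i, (b i : S) ∈ I ∧ (b i : S).IsHomogeneous 1 := fun i => mem_gradedPiece.1 (b i).2
  have hspan : ∀ F ∈ I, F.IsHomogeneous 1 → F ∈ Ideal.span {(b 0 : S), (b 1 : S)} := by
    intro F hF hF1
    have h1 := congrArg Subtype.val (b.sum_repr ⟨F, mem_gradedPiece.2 ⟨hF, hF1⟩⟩)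
    rw [Fin.sum_univ_two, Submodule.coe_add, Submodule.coe_smul, Submodule.coe_smul,
      smul_eq_C_mul, smul_eq_C_mul] at h1
    exact Ideal.mem_span_pair.2 ⟨_, _, h1⟩
  have hnd : ∀ i j, i ≠ j → ¬ (b i : S) ∣ b j := by
    intro i j hij hdvd
    obtain ⟨c, hc, hbc⟩ := IsHomogeneous.exists_eq_mul_of_dvd (n := 0) (hb i).2 (hb j).2 hdvd
    obtain ⟨s, rfl⟩ := IsHomogeneous.eq_C hc
    have h1 : b j = s • b i := Subtype.ext (by rw [hbc, Submodule.coe_smul, smul_eq_C_mul, mul_comm])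
    have h2 := congrArg (fun x => b.repr x j) h1
    simp [hij] at h2
  refine ⟨b 0, b 1, (hb 0).2, (hb 1).2, ?_, hnd 0 1 (by decide), hnd 1 0 (by decide)⟩
  have hle : Ideal.span {(b 0 : S), (b 1 : S)} ≤ I := by
    rw [Ideal.span_le]
    rintro _ (rfl | rfl)
    exacts [(hb 0).1, (hb 1).1]
  refine le_antisymm (le_of_graded_generation hI (isGradedIdeal_span_pair (hb 0).2 (hb 1).2)
    hle hℓ hreg (j := 0) ?_ ?_) hle
  · intro k hk F hF hFk
    obtain rfl : k = 0 := by omega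
    have : F ∈ gradedPiece I 0 := mem_gradedPiece.2 ⟨hF, hFk⟩
    rw [f0, Submodule.mem_bot] at this
    rw [this]; exact zero_mem _
  · intro F hF
    obtain ⟨G, hG, hFG⟩ := exists_sub_mul_mem hI hℓ hF ((hn 0 (by omega)).2 F hF)
    rw [← sub_add_cancel F (ℓ * G)]
    refine add_mem (Ideal.mem_sup_left (hspan _ hFG (hF.sub ?_)))
      (Ideal.mem_sup_right (Ideal.mem_span_singleton.2 (Dvd.intro _ rfl)))
    exact hℓ.mul hG

/-- The Hilbert function of `S / I` is `1, 2, 2, …`, so `I` has dimensions `0, 1, 4` in degrees `0,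
1, 2`. The multiples of the linear form `p` fill only three of the four dimensions in degree `2`,
leaving one further quadric `q`. -/
theorem exists_linear_quadratic_generators (hI : IsGradedIdeal I)
    (hℓ : ℓ.IsHomogeneous 1) (hreg : ∀ h, ℓ * h ∈ I → h ∈ I)
    (hlim : ∃ K, ∀ k ≥ K, Module.finrank ℂ (quotientPiece I k) = 2) :
    ∃ p q : S, p.IsHomogeneous 1 ∧ q.IsHomogeneous 2 ∧ I = Ideal.span {p, q} ∧
      ¬ p ∣ q ∧ ¬ q ∣ p := by
  obtain ⟨h0, hn⟩ := finrank_quotientPiece_eq two_pos hI hℓ hreg hlim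
  have e0 := finrank_quotientPiece_add I 0
  have e1 := finrank_quotientPiece_add I 1
  have e2 := finrank_quotientPiece_add I 2
  rw [h0] at e0
  rw [(hn 1 (by omega)).1] at e1
  rw [(hn 2 (by omega)).1] at e2
  have c0 : (0 + 2).choose 2 = 1 := rfl
  have c1 : (1 + 2).choose 2 = 3 := rfl
  have c2 : (2 + 2).choose 2 = 6 := rfl
  rw [c0] at e0
  rw [c1] at e1
  rw [c2] at e2
  have f0 : gradedPiece I 0 = ⊥ := Submodule.finrank_eq_zero.1 (by omega)
  have f1 : Module.finrank ℂ (gradedPiece I 1) = 1 := by omega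
  have f2 : Module.finrank ℂ (gradedPiece I 2) = 4 := by omega
  obtain ⟨⟨p, hp⟩, hp0, hp1⟩ := finrank_eq_one_iff'.1 f1
  have hp0 : p ≠ 0 := fun h => hp0 (Subtype.ext h)
  obtain ⟨hpI, hph⟩ := mem_gradedPiece.1 hp
  have hinj : Function.Injective (LinearMap.mulLeft ℂ p) := fun F G h => mul_left_cancel₀ hp0 h
  set W := (forms 1).map (LinearMap.mulLeft ℂ p) with hW
  have hWf : Module.finrank ℂ W = 3 := by
    rw [hW, finrank_map_of_injective _ hinj, finrank_forms, c1]
  have hWle : W ≤ gradedPiece I 2 := by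
    rintro _ ⟨F, hF, rfl⟩
    exact mem_gradedPiece.2 ⟨I.mul_mem_right _ hpI, hph.mul hF⟩
  have hWlt : W < gradedPiece I 2 := by
    refine lt_of_le_of_ne hWle fun h => ?_
    rw [h, f2] at hWf
    omega
  obtain ⟨q, hq, hqW⟩ := SetLike.exists_of_lt hWlt
  obtain ⟨hqI, hqh⟩ := mem_gradedPiece.1 hq
  have hsup : W ⊔ Submodule.span ℂ {q} = gradedPiece I 2 := by
    have hle : W ⊔ Submodule.span ℂ {q} ≤ gradedPiece I 2 :=
      sup_le hWle ((Submodule.span_singleton_le_iff_mem _ _).2 hq)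
    have hfd : FiniteDimensional ℂ ↥(W ⊔ Submodule.span ℂ {q}) :=
      Submodule.finiteDimensional_of_le hle
    refine Submodule.eq_of_le_of_finrank_le hle ?_
    have hlt : W < W ⊔ Submodule.span ℂ {q} := by
      refine lt_of_le_of_ne le_sup_left fun h => hqW ?_
      rw [h]
      exact Submodule.mem_sup_right (Submodule.mem_span_singleton_self q)
    have := Submodule.finrank_lt_finrank_of_lt hlt
    omega
  have hspan : ∀ F ∈ I, F.IsHomogeneous 2 → F ∈ Ideal.span {p, q} := by
    intro F hF hF2
    have h1 : F ∈ W ⊔ Submodule.span ℂ {q} := hsup ▸ mem_gradedPiece.2 ⟨hF, hF2⟩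
    obtain ⟨_, ⟨G, -, rfl⟩, _, hq', rfl⟩ := Submodule.mem_sup.1 h1
    obtain ⟨s, rfl⟩ := Submodule.mem_span_singleton.1 hq'
    exact Ideal.mem_span_pair.2 ⟨G, C s, by
      rw [LinearMap.mulLeft_apply, smul_eq_C_mul, mul_comm G]⟩
  have hq0 : ¬ p ∣ q := fun h => by
    obtain ⟨c, hc, rfl⟩ := IsHomogeneous.exists_eq_mul_of_dvd (n := 1) hph hqh h
    exact hqW ⟨c, hc, rfl⟩
  refine ⟨p, q, hph, hqh, ?_, hq0, IsHomogeneous.not_dvd_of_lt hqh hph hp0 (by omega)⟩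
  have hle : Ideal.span {p, q} ≤ I := by
    rw [Ideal.span_le]
    rintro _ (rfl | rfl)
    exacts [hpI, hqI]
  refine le_antisymm (le_of_graded_generation hI (isGradedIdeal_span_pair hph hqh)
    hle hℓ hreg (j := 1) ?_ ?_) hle
  · intro k hk F hF hFk
    rcases Nat.le_one_iff_eq_zero_or_eq_one.1 hk with rfl | rfl
    · have : F ∈ gradedPiece I 0 := mem_gradedPiece.2 ⟨hF, hFk⟩
      rw [f0, Submodule.mem_bot] at this
      rw [this]; exact zero_mem _
    · obtain ⟨s, hs⟩ := hp1 ⟨F, mem_gradedPiece.2 ⟨hF, hFk⟩⟩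
      have hs' : s • p = F := congrArg Subtype.val hs
      rw [← hs', smul_eq_C_mul]
      exact Ideal.mul_mem_left _ _ (Ideal.subset_span (by simp))
  · intro F hF
    obtain ⟨G, hG, hFG⟩ := exists_sub_mul_mem hI hℓ hF ((hn 1 (by omega)).2 F hF)
    rw [← sub_add_cancel F (ℓ * G)]
    refine add_mem (Ideal.mem_sup_left (hspan _ hFG (hF.sub ?_)))
      (Ideal.mem_sup_right (Ideal.mem_span_singleton.2 (Dvd.intro _ rfl)))
    exact hℓ.mul hG

end SmallDegree

/-- The Hilbert function of the ideal generated by coprime forms of degrees `1` and `n`. -/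
theorem finrank_gradedPiece_span_pair {p q : S} {n : ℕ} (hp : p.IsHomogeneous 1)
    (hq : q.IsHomogeneous n) (hp0 : p ≠ 0) (hpq : ¬ p ∣ q) (m : ℕ) :
    Module.finrank ℂ (gradedPiece (Ideal.span {p, q}) (m + n + 1)) + (m + 2).choose 2 =
      (m + n + 2).choose 2 + (m + 1 + 2).choose 2 := by
  have hpp : Prime p := prime_of_totalDegree_eq_one (hp.totalDegree hp0)
  let ψ : S × S →ₗ[ℂ] S := (LinearMap.mulLeft ℂ p).coprod (LinearMap.mulLeft ℂ q)
  have hψ : ∀ u v, ψ (u, v) = p * u + q * v := fun u v => by simp [ψ]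
  -- The Koszul relation: since `p` is prime and does not divide `q`, it generates all relations
  -- between `p` and `q`.
  let κ : S →ₗ[ℂ] S × S := (LinearMap.mulLeft ℂ q).prod (-LinearMap.mulLeft ℂ p)
  have hκ : ∀ w, κ w = (q * w, -(p * w)) := fun w => by simp [κ]
  have hκinj : Function.Injective κ := fun v w h => by
    rw [hκ, hκ, Prod.mk.injEq, neg_inj] at h
    exact mul_left_cancel₀ hp0 h.2
  let P : Submodule ℂ (S × S) := (forms (m + n)).prod (forms (m + 1))
  have hPe : P = LinearMap.range ((forms (m + n)).subtype.prodMap (forms (m + 1)).subtype) := by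
    rw [LinearMap.range_prodMap, Submodule.range_subtype, Submodule.range_subtype]
  have hPinj : Function.Injective ((forms (m + n)).subtype.prodMap (forms (m + 1)).subtype) :=
    Function.Injective.prodMap (Submodule.injective_subtype _) (Submodule.injective_subtype _)
  have hPf : Module.finrank ℂ P = (m + n + 2).choose 2 + (m + 1 + 2).choose 2 := by
    rw [hPe, LinearMap.finrank_range_of_inj hPinj, Module.finrank_prod, finrank_forms,
      finrank_forms]
  have hfd : FiniteDimensional ℂ P := by rw [hPe]; infer_instance
  have h1 := finrank_map_add_finrank_inf_ker ψ P
  have h2 : P.map ψ = gradedPiece (Ideal.span {p, q}) (m + n + 1) := by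
    ext F
    rw [mem_gradedPiece]
    constructor
    · rintro ⟨⟨u, v⟩, ⟨hu, hv⟩, rfl⟩
      rw [hψ]
      refine ⟨Ideal.mem_span_pair.2 ⟨u, v, by ring⟩, ?_⟩
      have a1 := hp.mul (show u.IsHomogeneous (m + n) from hu)
      have a2 := hq.mul (show v.IsHomogeneous (m + 1) from hv)
      rw [add_comm 1] at a1
      rw [show n + (m + 1) = m + n + 1 by ring] at a2
      exact a1.add a2
    · rintro ⟨hF, hFh⟩
      rw [← Matrix.range_cons_cons_empty p q ![]] at hF
      obtain ⟨c, hc, hcF⟩ := exists_homogeneous_coeff (a := ![p, q]) (n := ![1, n])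
        (fun i => by fin_cases i <;> simpa) hFh
        (fun i => by fin_cases i <;> simp; omega) hF
      refine ⟨(c 0, c 1), ⟨?_, ?_⟩, ?_⟩
      · exact hc 0
      · have : (c 1).IsHomogeneous (m + n + 1 - n) := hc 1
        rw [show m + n + 1 - n = m + 1 by omega] at this
        exact this
      · rw [hψ, ← hcF, Fin.sum_univ_two]
        simp [mul_comm]
  have h3 : P ⊓ LinearMap.ker ψ = (forms m).map κ := by
    ext ⟨u, v⟩
    rw [Submodule.mem_inf, LinearMap.mem_ker, hψ, Submodule.mem_map]
    constructor
    · rintro ⟨⟨hu, hv⟩, h0⟩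
      have hdvd : p ∣ q * v := ⟨-u, by linear_combination h0⟩
      obtain ⟨w, hw, hvw⟩ := IsHomogeneous.exists_eq_mul_of_dvd (n := m) hp
        (by rw [add_comm]; exact hv) ((hpp.dvd_or_dvd hdvd).resolve_left hpq)
      refine ⟨-w, (forms m).neg_mem hw, ?_⟩
      rw [hκ, Prod.mk.injEq]
      refine ⟨mul_left_cancel₀ hp0 ?_, by rw [hvw]; ring⟩
      rw [hvw] at h0
      linear_combination -h0
    · rintro ⟨w, hw, hwe⟩
      rw [hκ, Prod.mk.injEq] at hwe
      obtain ⟨rfl, rfl⟩ := hwe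
      refine ⟨⟨?_, ?_⟩, by ring⟩
      · have := hq.mul (show w.IsHomogeneous m from hw)
        rwa [add_comm] at this
      · have := (hp.mul (show w.IsHomogeneous m from hw)).neg
        rwa [add_comm] at this
  rw [h2, h3, finrank_map_of_injective _ hκinj, finrank_forms, hPf] at h1
  exact h1

/-! ### Three-syzygy curves and the defect of the total Tjurina number -/

theorem ne_fin_three_image {α : Type*} (r : Fin 3 → α) :
    r '' {j | j ≠ 0} = {r 1, r 2} ∧ r '' {j | j ≠ 1} = {r 0, r 2} ∧
      r '' {j | j ≠ 2} = {r 0, r 1} := by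
  refine ⟨?_, ?_, ?_⟩ <;> ext x <;> simp [Fin.exists_fin_succ, eq_comm]

theorem defect_eq_of_cofactorIdeal_eq {d r n : ℕ} {f : S} (hf : IsReducedCurve d f) (hd : 0 < d)
    {a : Fin 3 → S} (ha : IsMinimalSyzygy f r a) {p q : S} (hp : p.IsHomogeneous 1)
    (hq : q.IsHomogeneous n) (hp0 : p ≠ 0) (hpq : ¬ p ∣ q)
    (hI : cofactorIdeal f a = Ideal.span {p, q}) :
    (totalTjurina f : ℤ) = tauMax d r - n := by
  obtain ⟨K, hK⟩ := exists_finrank_cofactorIdeal hf hd ha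
  have h1 := hK (K + n + 1) (by omega)
  have h2 := finrank_gradedPiece_span_pair hp hq hp0 hpq K
  rw [← hI] at h2
  zify at h2
  have c1 := two_mul_choose_two K
  have c2 := two_mul_choose_two (K + n)
  have c3 := two_mul_choose_two (K + 1)
  have c4 := two_mul_choose_two (K + n + 1)
  push_cast at h1 h2 c1 c2 c3 c4
  apply mul_left_cancel₀ (two_ne_zero (α := ℤ))
  linear_combination 2 * h2 - 2 * h1 + c2 + c3 - c4 - c1

/-- The cofactors `p`, `q` of the last two generators generate the cofactor ideal, in degrees `e 0 +
e 1 - (d - 1) = 1` and `e 0 + e 2 - (d - 1) = n`. Minimality of the generators translates into `p ≠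
0` and `p ∤ q`. -/
theorem IsMinimalGenerators.totalTjurina_eq {d n : ℕ} {f : S} (hf : IsReducedCurve d f)
    (hd : 0 < d) {e : Fin 3 → ℕ} (he : Monotone e) {r : Fin 3 → Fin 3 → S}
    (hr : IsMinimalGenerators f e r) (h01 : e 0 + e 1 = d) (h12 : e 1 + n = e 2 + 1) :
    (totalTjurina f : ℤ) = tauMax d (e 0) - n := by
  have ha : IsMinimalSyzygy f (e 0) (r 0) := hr.isMinimalSyzygy he (by omega)
  have hmem : ∀ i, r i ∈ syzygies f := fun i => hr.span_eq ▸ Submodule.subset_span ⟨i, rfl⟩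
  obtain ⟨i0, i1, i2⟩ := ne_fin_three_image r
  have m1 := hr.minimal 1
  have m2 := hr.minimal 2
  rw [i1, Submodule.mem_span_pair] at m1
  rw [i2, Submodule.mem_span_pair] at m2
  obtain ⟨p, hp⟩ := exists_isCofactor hf hd ha.mem (hmem 1)
  obtain ⟨q, hq⟩ := exists_isCofactor hf hd ha.mem (hmem 2)
  have hph : p.IsHomogeneous 1 := hp.isHomogeneous hf hd ha.homogeneous (hr.homogeneous 1) (by omega)
  have hqh : q.IsHomogeneous n := hq.isHomogeneous hf hd ha.homogeneous (hr.homogeneous 2) (by omega)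
  have hp0 : p ≠ 0 := by
    rintro rfl
    obtain ⟨s, hs⟩ := ha.exists_eq_smul hf.isHomogeneous hp
    exact m1 ⟨s, 0, by rw [zero_smul, add_zero, hs]⟩
  have hpq : ¬ p ∣ q := by
    rintro ⟨c, rfl⟩
    have h1 := hq.congr_add (hp.smul (-c))
    rw [neg_mul, mul_comm c, add_neg_cancel] at h1
    obtain ⟨s, hs⟩ := ha.exists_eq_smul hf.isHomogeneous h1
    refine m2 ⟨s, c, ?_⟩
    rw [← hs, neg_smul]; abel
  refine defect_eq_of_cofactorIdeal_eq hf hd ha hph hqh hp0 hpq (le_antisymm ?_ ?_)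
  · intro h hh
    obtain ⟨b, hb, hab⟩ := mem_cofactorIdeal.1 hh
    rw [← hr.span_eq] at hb
    obtain ⟨c, rfl⟩ := (Submodule.mem_span_range_iff_exists_fun S).1 hb
    rw [Fin.sum_univ_three] at hab
    have h1 := ((isCofactor_smul_self f (r 0) (c 0)).congr_add (hp.smul (c 1))).congr_add
      (hq.smul (c 2))
    rw [hab.unique hf hd h1, zero_add]
    exact Ideal.mem_span_pair.2 ⟨c 1, c 2, rfl⟩
  · rw [Ideal.span_le]
    rintro _ (rfl | rfl)
    exacts [mem_cofactorIdeal.2 ⟨_, hmem 1, hp⟩, mem_cofactorIdeal.2 ⟨_, hmem 2, hq⟩]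

/-! ### From two generators of the cofactor ideal to three exponents -/

theorem exists_homogeneous_cofactor {d r j : ℕ} {f : S} (hf : IsReducedCurve d f) (hd : 0 < d)
    {a : Fin 3 → S} (ha : IsMinimalSyzygy f r a) {h : S} (hh : h ∈ cofactorIdeal f a)
    (hhom : h.IsHomogeneous j) : ∃ b ∈ syzygies f, (∀ i, (b i).IsHomogeneous (d - 1 - r + j)) ∧
      IsCofactor f a b h := by
  obtain ⟨b, hb, hab⟩ := mem_cofactorIdeal.1 hh
  have hr := ha.le hf hd
  have h1 := hab.homogeneousComponent hf ha.homogeneous (k := d - 1 - r + j) (j := j) (by omega)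
  rw [homogeneousComponent_eq_self hhom] at h1
  exact ⟨_, homogeneousComponent_mem_syzygies hf.isHomogeneous hb _,
    fun i => homogeneousComponent_isHomogeneous _ _, h1⟩

/-- Lift `p` and `q` to syzygies `b` and `c`. Any syzygy minus a combination of `b` and `c` has
cofactor `0`, hence is a multiple of `a`. The conditions `q ∤ p` and `p ∤ q` make `b` and `c`
irredundant; `a` is irredundant by degree. -/
theorem IsMinimalSyzygy.exists_exponents {d r n : ℕ} {f : S} (hf : IsReducedCurve d f)
    (hd : 0 < d) (hn : 0 < n) {a : Fin 3 → S} (ha : IsMinimalSyzygy f r a) {p q : S}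
    (hp : p.IsHomogeneous 1) (hq : q.IsHomogeneous n) (hpq : ¬ p ∣ q) (hqp : ¬ q ∣ p)
    (hI : cofactorIdeal f a = Ideal.span {p, q}) :
    ∃ e : Fin 3 → ℕ, HasExponents f e ∧ e 0 + e 1 = d ∧ e 1 + n = e 2 + 1 := by
  have hr := ha.le hf hd
  have hp0 : p ≠ 0 := fun h => hqp (h ▸ dvd_zero q)
  have hpp : Prime p := prime_of_totalDegree_eq_one (hp.totalDegree hp0)
  obtain ⟨b, hb, hbh, hab⟩ := exists_homogeneous_cofactor hf hd ha
    (hI ▸ Ideal.subset_span (by simp)) hp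
  obtain ⟨c, hc, hch, hac⟩ := exists_homogeneous_cofactor hf hd ha
    (hI ▸ Ideal.subset_span (by simp)) hq
  have ha0 : IsCofactor f a a 0 := by
    have := isCofactor_smul_self f a 1
    rwa [one_smul] at this
  have hb0 : b ≠ 0 := by
    rintro rfl
    refine hp0 (hab.unique hf hd ?_)
    have := isCofactor_smul_self f a 0
    rwa [zero_smul] at this
  have hrb : r ≤ d - 1 - r + 1 := ha.minimal b hb _ hbh hb0
  refine ⟨![r, d - 1 - r + 1, d - 1 - r + n], ⟨?_, ![a, b, c], ?_, ?_, ?_⟩, ?_, ?_⟩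
  · rw [Fin.monotone_iff_le_succ]
    intro i
    fin_cases i
    · exact hrb
    · change d - 1 - r + 1 ≤ d - 1 - r + n
      omega
  · intro i j
    fin_cases i
    exacts [ha.homogeneous j, hbh j, hch j]
  · refine le_antisymm (Submodule.span_le.2 ?_) fun x hx => ?_
    · rintro _ ⟨i, rfl⟩
      fin_cases i
      exacts [ha.mem, hb, hc]
    · obtain ⟨h, hh⟩ := exists_isCofactor hf hd ha.mem hx
      have hm : h ∈ cofactorIdeal f a := mem_cofactorIdeal.2 ⟨x, hx, hh⟩
      rw [hI] at hm
      obtain ⟨s, t, rfl⟩ := Ideal.mem_span_pair.1 hm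
      have h1 := (hh.congr_add (hab.smul (-s))).congr_add (hac.smul (-t))
      have h2 : s * p + t * q + -s * p + -t * q = 0 := by ring
      rw [h2] at h1
      obtain ⟨u, hu⟩ := ha.exists_eq_smul hf.isHomogeneous h1
      have hx' : x = u • a + s • b + t • c := by
        rw [← hu, neg_smul, neg_smul]; abel
      rw [hx']
      have hmem : ∀ i, (![a, b, c] : Fin 3 → Fin 3 → S) i ∈
          Submodule.span S (Set.range ![a, b, c]) := fun i => Submodule.subset_span ⟨i, rfl⟩
      exact add_mem (add_mem (Submodule.smul_mem _ _ (hmem 0)) (Submodule.smul_mem _ _ (hmem 1)))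
        (Submodule.smul_mem _ _ (hmem 2))
  · obtain ⟨i0, i1, i2⟩ := ne_fin_three_image (![a, b, c] : Fin 3 → Fin 3 → S)
    intro i
    fin_cases i
    · change a ∉ Submodule.span S (![a, b, c] '' {j | j ≠ 0})
      rw [i0, Submodule.mem_span_pair]
      rintro ⟨s, t, hst⟩
      change s • b + t • c = a at hst
      have h1 := (hab.smul s).congr_add (hac.smul t)
      rw [hst] at h1
      have h2 := h1.unique hf hd ha0
      -- Comparing cofactors gives `s p + t q = 0`, so `(s, t)` is a multiple of `(-q, p)` and `a =
      -- u (p c - q b)`. The right side starts in degree `d - r + n`, which exceeds `r`.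
      obtain ⟨u, rfl⟩ : p ∣ t := by
        refine (hpp.dvd_or_dvd (⟨-s, ?_⟩ : p ∣ t * q)).resolve_right hpq
        linear_combination h2
      have hs : s = -(u * q) := mul_right_cancel₀ hp0 (by linear_combination h2)
      apply ha.ne_zero
      funext i
      have h3 : a i = (p * c i - q * b i) * u := by
        rw [← hst, hs]
        simp only [Pi.add_apply, Pi.smul_apply, smul_eq_mul]
        ring
      have h4 : (p * c i - q * b i).IsHomogeneous (d - 1 - r + 1 + n) := by
        have a1 := hp.mul (hch i)
        have a2 := hq.mul (hbh i)
        rw [show 1 + (d - 1 - r + n) = d - 1 - r + 1 + n by ring] at a1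
        rw [show n + (d - 1 - r + 1) = d - 1 - r + 1 + n by ring] at a2
        exact a1.sub a2
      rw [← homogeneousComponent_eq_self (ha.homogeneous i), h3,
        homogeneousComponent_homogeneous_mul_of_lt h4 _ (by omega)]
      rfl
    · change b ∉ Submodule.span S (![a, b, c] '' {j | j ≠ 1})
      rw [i1, Submodule.mem_span_pair]
      rintro ⟨s, t, hst⟩
      change s • a + t • c = b at hst
      have h1 := (ha0.smul s).congr_add (hac.smul t)
      rw [hst] at h1
      exact hqp ⟨t, by rw [hab.unique hf hd h1]; ring⟩
    · change c ∉ Submodule.span S (![a, b, c] '' {j | j ≠ 2})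
      rw [i2, Submodule.mem_span_pair]
      rintro ⟨s, t, hst⟩
      change s • a + t • b = c at hst
      have h1 := (ha0.smul s).congr_add (hab.smul t)
      rw [hst] at h1
      exact hpq ⟨t, by rw [hac.unique hf hd h1]; ring⟩
  · change r + (d - 1 - r + 1) = d
    omega
  · change d - 1 - r + 1 + n = d - 1 - r + n + 1
    ring

theorem exists_finrank_quotientPiece {d r n : ℕ} {f : S} (hf : IsReducedCurve d f) (hd : 0 < d)
    {a : Fin 3 → S} (ha : IsMinimalSyzygy f r a) (h : (totalTjurina f : ℤ) = tauMax d r - n) :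
    ∃ K, ∀ k ≥ K, Module.finrank ℂ (quotientPiece (cofactorIdeal f a) k) = n := by
  obtain ⟨K, hK⟩ := exists_finrank_cofactorIdeal hf hd ha
  refine ⟨K, fun k hk => ?_⟩
  have h1 := hK k hk
  have h2 := finrank_quotientPiece_add (cofactorIdeal f a) k
  zify at h2 ⊢
  linarith

/-- Both parts of the theorem at once: `n` is the defect of the total Tjurina number, and also the
degree of the second generator of the cofactor ideal. -/
theorem IsMinimalSyzygy.exponents_iff {d r n : ℕ} {f : S} (hf : IsReducedCurve d f)
    (hd : 0 < d) (hn : n = 1 ∨ n = 2) {a : Fin 3 → S} (ha : IsMinimalSyzygy f r a) :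
    (∃ e : Fin 3 → ℕ, HasExponents f e ∧ e 0 + e 1 = d ∧ e 1 + n = e 2 + 1) ↔
      (totalTjurina f : ℤ) = tauMax d r - n := by
  constructor
  · rintro ⟨e, ⟨he, g, hg⟩, h01, h12⟩
    have hg0 : IsMinimalSyzygy f (e 0) (g 0) := hg.isMinimalSyzygy he (by omega)
    have : r = e 0 := le_antisymm
      (ha.minimal _ hg0.mem _ hg0.homogeneous hg0.ne_zero)
      (hg0.minimal _ ha.mem _ ha.homogeneous ha.ne_zero)
    rw [this]
    exact hg.totalTjurina_eq hf hd he h01 h12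
  · intro h
    have hlim := exists_finrank_quotientPiece hf hd ha h
    have hgr := isGradedIdeal_cofactorIdeal hf hd ha
    obtain ⟨ℓ, hℓ, hreg⟩ := exists_linearForm_regular hf ha
    rcases hn with rfl | rfl
    · obtain ⟨p, q, hp, hq, hI, hpq, hqp⟩ := exists_two_linear_generators hgr hℓ hreg hlim
      exact ha.exists_exponents hf hd one_pos hp hq hpq hqp hI
    · obtain ⟨p, q, hp, hq, hI, hpq, hqp⟩ := exists_linear_quadratic_generators hgr hℓ hreg hlim
      exact ha.exists_exponents hf hd two_pos hp hq hpq hqp hI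

end PlaneCurve


theorem corollary5p4 (d : ℕ) (hd : 3 ≤ d) (f : PlaneCurve.S)
    (hf : PlaneCurve.IsReducedCurve d f) (m : ℕ) (hm : 0 < m) (e : Fin m → ℕ)
    (he : PlaneCurve.HasExponents f e) :
    (PlaneCurve.IsNearlyFree d f ↔
      (PlaneCurve.totalTjurina f : ℤ) = PlaneCurve.tauMax d (e ⟨0, hm⟩) - 1) ∧
    (PlaneCurve.IsMinimalPlusOneGenerated d f ↔
      (PlaneCurve.totalTjurina f : ℤ) = PlaneCurve.tauMax d (e ⟨0, hm⟩) - 2) := by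
  obtain ⟨he, r, hr⟩ := he
  have ha := hr.isMinimalSyzygy he hm
  have hd0 : 0 < d := by omega
  -- The relation `e 1 + n = e 2 + 1` reads `e 1 = e 2` for `n = 1` and `e 1 + 1 = e 2` for `n = 2`.
  refine ⟨(exists_congr fun e' => ?_).trans (ha.exponents_iff hf hd0 (n := 1) (Or.inl rfl)),
    (exists_congr fun e' => ?_).trans (ha.exponents_iff hf hd0 (n := 2) (Or.inr rfl))⟩
  · exact and_congr_right fun _ => and_congr_right fun _ => by omega
  · exact and_congr_right fun _ => and_congr_right fun _ => by omega
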